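/- Let $a$ and $q$ be independent indeterminates. Write $(x;q)_0=1$, $(x;q)_k=(1-x)(1-xq)\cdots(1-xq^{k-1})$ for $k\ge 1$, $(x_1,\dots,x_m;q)_k=(x_1;q)_k\cdots(x_m;q)_k$, $[r]=(1-q^r)/(1-q)=1+q+\cdots+q^{r-1}$, and let $\Phi_n(q)$ be the $n$-th cyclotomic polynomial. For rational functions $A,B$ of $a$ and $q$ and a polynomial $P\in\mathbb{Z}[a,q]$, the congruence $A\equiv B\pmod{P}$ means that $A-B=PN/D$ for some polynomials $N,D\in\mathbb{Z}[a,q]$ with $D\neq 0$ relatively prime to $P$. Let $n$ be a positive odd integer and, for integers $k\ge 0$, put $$\lambda_q(k)=[4k+1]\,\frac{(q;q^2)_k^2\,(aq,q/a;q^2)_k}{(q^2;q^2)_k^2\,(q^2/a,aq^2;q^2)_k}.$$ Then, modulo $[n]\Phi_n(q)^2(1-aq^n)(a-q^n)$, $$\sum_{\substack{i,j\ge 0\\ i+j\le n-1}}\lambda_q(i)\lambda_q(j)\equiv [n]^2q^{1-n}+[n]^2q^{1-n}\,\frac{(1-aq^n)(a-q^n)}{(1-a)^2}\left\{1-\frac{(q^2;q^2)_{(n-1)/2}^4}{(aq^2,q^2/a;q^2)_{(n-1)/2}^2}\right\}.$$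 -/

import Mathlib

namespace QDouble

/-- The ring `ℤ[a][q]` of polynomials in two independent indeterminates: the outer variable is `q`,
the inner one is `a`. -/
abbrev PolyAQ : Type := Polynomial (Polynomial ℤ)

/-- The field `ℚ(a, q)` of rational functions in `a` and `q`. -/
abbrev RatAQ : Type := FractionRing PolyAQ

/-- The indeterminate `q` as a polynomial. -/
noncomputable def polyQ : PolyAQ := Polynomial.X

/-- The indeterminate `a` as a polynomial. -/
noncomputable def polyA : PolyAQ := Polynomial.C Polynomial.X

/-- The indeterminate `q` as a rational function. -/
noncomputable def ratQ : RatAQ := algebraMap PolyAQ RatAQ polyQ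

/-- The indeterminate `a` as a rational function. -/
noncomputable def ratA : RatAQ := algebraMap PolyAQ RatAQ polyA

/-- The `q`-integer `[r] = 1 + q + ⋯ + q ^ (r - 1) = (1 - q ^ r) / (1 - q)`. -/
def qInt {R : Type*} [CommRing R] (q : R) (r : ℕ) : R :=
  ∑ i ∈ Finset.range r, q ^ i

theorem qInt_eq_div {F : Type*} [Field F] (q : F) (hq : q ≠ 1) (r : ℕ) :
    qInt q r = (1 - q ^ r) / (1 - q) := by
  rw [qInt, geom_sum_eq hq, ← neg_sub (1 : F) (q ^ r), ← neg_sub (1 : F) q, neg_div_neg_eq]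

/-- The `q`-shifted factorial `(x; q)_k = (1 - x) (1 - x q) ⋯ (1 - x q ^ (k - 1))`. -/
def qPoch {R : Type*} [CommRing R] (x q : R) (k : ℕ) : R :=
  ∏ i ∈ Finset.range k, (1 - x * q ^ i)

/-- The summand
`[4k+1] (q; q²)_k² (aq, q/a; q²)_k / ((q²; q²)_k² (q²/a, aq²; q²)_k)`. -/
def lam {F : Type*} [Field F] (a q : F) (k : ℕ) : F :=
  qInt q (4 * k + 1) *
    ((qPoch q (q ^ 2) k ^ 2 * (qPoch (a * q) (q ^ 2) k * qPoch (q / a) (q ^ 2) k)) /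
      (qPoch (q ^ 2) (q ^ 2) k ^ 2 *
        (qPoch (q ^ 2 / a) (q ^ 2) k * qPoch (a * q ^ 2) (q ^ 2) k)))

/-- The double sum `∑ λ_q(i) λ_q(j)` over all `i, j ≥ 0` with `i + j ≤ N`. -/
def doubleSum {F : Type*} [Field F] (a q : F) (N : ℕ) : F :=
  ∑ p ∈ (Finset.range (N + 1) ×ˢ Finset.range (N + 1)).filter (fun p => p.1 + p.2 ≤ N),
    lam a q p.1 * lam a q p.2

/-- Congruence `A ≡ B (mod P)` of rational functions modulo a polynomial `P`: the difference
`A - B` is `P * N / D` with polynomials `N` and `D`, where `D` is relatively prime to `P`. -/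
def RatModEq (P : PolyAQ) (A B : RatAQ) : Prop :=
  ∃ N D : PolyAQ, D ≠ 0 ∧ IsRelPrime D P ∧
    A - B = algebraMap PolyAQ RatAQ (P * N) / algebraMap PolyAQ RatAQ D

/-- The modulus `[n] Φ_n(q)² (1 - a q ^ n) (a - q ^ n)`. -/
noncomputable def modulus (n : ℕ) : PolyAQ :=
  qInt polyQ n * Polynomial.cyclotomic n (Polynomial ℤ) ^ 2 *
    ((1 - polyA * polyQ ^ n) * (polyA - polyQ ^ n))

end QDouble

/-! Write n = 2M + 1. Since [n] is the product of Φ_d over the divisors d ≠ 1 of n, for n > 1 the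
modulus is a product of the pairwise coprime factors Φ_d (d ≠ 1, n), Φ_n³, 1 - aq^n and a - q^n of
ℤ[a, q], each a prime or a prime power. A congruence is divisibility of a reduced numerator, so the
factors can be handled one at a time, each by computing in the residue field of the prime.

If a = q^n or a = q^(-n), then λ(k) = 0 for k > M. The double sum is then the square of ∑_{k ≤ M}
λ(k), which the terminating very-well-poised ₆φ₅ sum evaluates to [n] q^(-M) (`sum_lam_pow`).

If q is a primitive d-th root of unity with d = 2m + 1 > 1, reversing the q-factorials gives λ(m -
k) = -λ(k) (`lam_antisymm`). So λ sums to zero over 0..m, it vanishes on m+1..d-1, and λ(du + r) =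
c(u) λ(r) in the residue field. These facts make the whole double sum vanish, and [n] vanishes too.

For Φ_n³ put ε = 1 - q^n. The double sum is S² + 2T, with S = ∑_{k ≤ M} λ(k) and T collecting the
pairs with one index above M. Each summand of T carries ε², and T/ε² is zero at a root of unity by
antisymmetry. For S, the ₆φ₅ sum exactly evaluates ∑ λ(k) g(k), where g(k) = 1 + ε h(k) is a
perturbation of 1. The first-order correction ∑ λ(k) h(k) dies at the root of unity, again by
antisymmetry, so S/ε is known there. Its square agrees with the closed form because (q;q²)_M⁴ = q
(q²;q²)_M⁴ when q^n = 1. -/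

namespace QDouble

/-! ### q-shifted factorials -/

section qPochhammer

variable {R : Type*} [CommRing R]

theorem qPoch_zero (x q : R) : qPoch x q 0 = 1 := by simp [qPoch]

theorem qPoch_succ (x q : R) (k : ℕ) : qPoch x q (k + 1) = qPoch x q k * (1 - x * q ^ k) := by
  simp [qPoch, Finset.prod_range_succ]

theorem qPoch_add (x q : R) (m k : ℕ) :
    qPoch x q (m + k) = qPoch x q m * qPoch (x * q ^ m) q k := by
  simp only [qPoch, Finset.prod_range_add]
  congr 1
  exact Finset.prod_congr rfl fun i _ => by ring

theorem qPoch_one_add (x q : R) (k : ℕ) :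
    qPoch x q (1 + k) = (1 - x) * qPoch (x * q) q k := by
  rw [qPoch_add, qPoch_succ, qPoch_zero]; simp

theorem qPoch_ne_zero_iff [IsDomain R] {x q : R} {k : ℕ} :
    qPoch x q k ≠ 0 ↔ ∀ i < k, 1 - x * q ^ i ≠ 0 := by
  simp [qPoch, Finset.prod_ne_zero_iff]

theorem qPoch_ne_zero_of_le [IsDomain R] {x q : R} {k m : ℕ} (h : k ≤ m) (hm : qPoch x q m ≠ 0) :
    qPoch x q k ≠ 0 :=
  qPoch_ne_zero_iff.2 fun i hi => qPoch_ne_zero_iff.1 hm i (hi.trans_le h)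

theorem qPoch_eq_zero {x q : R} {k i : ℕ} (hi : i < k) (h : x * q ^ i = 1) : qPoch x q k = 0 :=
  Finset.prod_eq_zero (Finset.mem_range.2 hi) (by rw [h, sub_self])

theorem one_sub_mul_qInt (q : R) (r : ℕ) : (1 - q) * qInt q r = 1 - q ^ r :=
  mul_neg_geom_sum q r

end qPochhammer

/-! ### The terminating ₆φ₅ summation -/

section wellPoised

variable {F : Type*} [Field F]

/-- The summand, without its factor `1 - A p ^ (2 k)`, of the terminating very-well-poised series
`₆φ₅` with base `p`, where `D = A p / B`, `E = A p / C` and `z = A p / (B C)`. -/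
def wpTerm (p A B C D E z : F) (N k : ℕ) : F :=
  qPoch A p k * qPoch B p k * qPoch C p k * (-z) ^ k * p ^ k.choose 2 /
    (qPoch p p k * qPoch D p k * qPoch E p k * qPoch p p (N - k) * qPoch (A * p) p (N + k))

variable {p A B C D E z : F}

theorem wpTerm_succ {N l m : ℕ} (h : N = m + 1 + l)
    (hp : qPoch p p N ≠ 0) (hD : qPoch D p N ≠ 0) (hE : qPoch E p N ≠ 0)
    (hA : qPoch (A * p) p (2 * N) ≠ 0) :
    wpTerm p A B C D E z N (m + 1) *
        ((1 - p ^ (m + 1)) * (1 - D * p ^ m) * (1 - E * p ^ m) * (1 - A * p ^ (N + m + 1))) =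
      wpTerm p A B C D E z N m * ((1 - A * p ^ m) * (1 - B * p ^ m) * (1 - C * p ^ m) *
        (-z * p ^ m) * (1 - p ^ (l + 1))) := by
  have h1 : N - m = l + 1 := by omega
  have h2 : N - (m + 1) = l := by omega
  have e1 := qPoch_succ p p m
  have e2 := qPoch_succ D p m
  have e3 := qPoch_succ E p m
  have e4 := qPoch_succ p p l
  have e5 := qPoch_succ (A * p) p (N + m)
  have n1 := qPoch_ne_zero_of_le (show m + 1 ≤ N by omega) hp
  have n2 := qPoch_ne_zero_of_le (show m + 1 ≤ N by omega) hD
  have n3 := qPoch_ne_zero_of_le (show m + 1 ≤ N by omega) hE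
  have n4 := qPoch_ne_zero_of_le (show l + 1 ≤ N by omega) hp
  have n5 := qPoch_ne_zero_of_le (show N + m + 1 ≤ 2 * N by omega) hA
  rw [e1] at n1
  rw [e2] at n2
  rw [e3] at n3
  rw [e4] at n4
  rw [e5] at n5
  have hc : (m + 1).choose 2 = m.choose 2 + m := by
    rw [Nat.choose_succ_succ' m 1, Nat.choose_one_right, add_comm]
  unfold wpTerm
  rw [h1, h2, ← add_assoc N m 1, e1, e2, e3, e4, e5, qPoch_succ A, qPoch_succ B, qPoch_succ C, hc]
  obtain ⟨a1, b1⟩ := mul_ne_zero_iff.1 n1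
  obtain ⟨a2, b2⟩ := mul_ne_zero_iff.1 n2
  obtain ⟨a3, b3⟩ := mul_ne_zero_iff.1 n3
  obtain ⟨a4, b4⟩ := mul_ne_zero_iff.1 n4
  obtain ⟨a5, b5⟩ := mul_ne_zero_iff.1 n5
  clear h hc h1 h2 e1 e2 e3 e4 e5
  rw [div_mul_eq_mul_div, div_mul_eq_mul_div, div_eq_div_iff (by simp [*]) (by simp [*])]
  ring

/-- A WZ-style certificate: the bracket encodes a first-order recurrence in `N` for the ₆φ₅ sum, and
the right side is its antidifference in `k`, vanishing at m = N. Powers p^(N-k) are written as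
quotients to avoid truncated subtraction. -/
theorem wp_telescope {N m : ℕ} (hm : m ≤ N) (p0 : p ≠ 0) (hB : B ≠ 0) (hC : C ≠ 0)
    (hBD : D = A * p / B) (hCE : E = A * p / C) (hz : z = A * p / (B * C))
    (hp : qPoch p p N ≠ 0) (hD : qPoch D p N ≠ 0) (hE : qPoch E p N ≠ 0)
    (hA : qPoch (A * p) p (2 * N) ≠ 0) :
    ∑ k ∈ Finset.range (m + 1), wpTerm p A B C D E z N k * ((1 - A * p ^ (2 * k)) *
      ((1 - p ^ N) * (1 - A * p ^ N / B) * (1 - A * p ^ N / C) -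
        (1 - p ^ N / p ^ k) * (1 - A * p ^ N * p ^ k) * (1 - A * p ^ N / (B * C)))) =
      p ^ N * wpTerm p A B C D E z N m * (A / (B * C)) * (1 - A * p ^ m) * (1 - B * p ^ m) *
        (1 - C * p ^ m) * (1 - p ^ N / p ^ m) := by
  induction m with
  | zero =>
    simp
    field_simp
    ring
  | succ m ih =>
    obtain ⟨l, hl⟩ := Nat.exists_eq_add_of_le hm
    have hs := wpTerm_succ (B := B) (C := C) (z := z) hl hp hD hE hA
    rw [Finset.sum_range_succ, ih (by omega)]
    set t := wpTerm p A B C D E z N m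
    set t' := wpTerm p A B C D E z N (m + 1)
    have h1 : (1 : F) - p ^ N / p ^ m = 1 - p ^ (l + 1) := by
      rw [hl, show m + 1 + l = m + (l + 1) by ring, pow_add, mul_div_cancel_left₀ _ (pow_ne_zero _ p0)]
    have key : t * (A / (B * C)) * (1 - A * p ^ m) * (1 - B * p ^ m) *
        (1 - C * p ^ m) * (1 - p ^ N / p ^ m) = - t' * (1 - p ^ (m + 1)) * (1 - D * p ^ m) *
          (1 - E * p ^ m) * (1 - A * p ^ (N + m + 1)) / p ^ (m + 1) := by
      rw [eq_div_iff (pow_ne_zero _ p0), h1]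
      have : A / (B * C) * p = z := by rw [hz]; ring
      rw [← this] at hs
      linear_combination hs
    have : p ^ N * t * (A / (B * C)) * (1 - A * p ^ m) * (1 - B * p ^ m) *
        (1 - C * p ^ m) * (1 - p ^ N / p ^ m) = p ^ N * (- t' * (1 - p ^ (m + 1)) * (1 - D * p ^ m) *
          (1 - E * p ^ m) * (1 - A * p ^ (N + m + 1)) / p ^ (m + 1)) := by
      rw [← key]; ring
    rw [this, hBD, hCE, show N + m + 1 = N + (m + 1) by ring, pow_add p N, pow_mul' p 2]
    have e : ∀ X : F, A * p / X * p ^ m = A * p ^ (m + 1) / X := fun X => by ring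
    rw [e, e]
    have y0 : p ^ (m + 1) ≠ 0 := pow_ne_zero _ p0
    generalize p ^ (m + 1) = y at *
    generalize p ^ N = x at *
    field_simp
    ring

/-- The terminating very-well-poised `₆φ₅` summation. -/
theorem sum_wpTerm (N : ℕ) (p0 : p ≠ 0) (hB : B ≠ 0) (hC : C ≠ 0)
    (hBD : D = A * p / B) (hCE : E = A * p / C) (hz : z = A * p / (B * C))
    (hp : qPoch p p N ≠ 0) (hD : qPoch D p N ≠ 0) (hE : qPoch E p N ≠ 0)
    (hA : qPoch (A * p) p (2 * N) ≠ 0) :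
    ∑ k ∈ Finset.range (N + 1), (1 - A * p ^ (2 * k)) * wpTerm p A B C D E z N k =
      (1 - A) * qPoch z p N / (qPoch p p N * qPoch D p N * qPoch E p N) := by
  induction N with
  | zero => simp [wpTerm, qPoch_zero]
  | succ N ih =>
    have ih := ih (qPoch_ne_zero_of_le (Nat.le_succ N) hp) (qPoch_ne_zero_of_le (Nat.le_succ N) hD)
      (qPoch_ne_zero_of_le (Nat.le_succ N) hE) (qPoch_ne_zero_of_le (by omega) hA)
    have tel := wp_telescope le_rfl p0 hB hC hBD hCE hz hp hD hE hA
    -- At m = N + 1 the boundary term vanishes, and so does the second half of the bracket in the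
    -- last summand, which has no counterpart in the sum for N.
    rw [div_self (pow_ne_zero _ p0), sub_self, mul_zero, Finset.sum_range_succ,
      div_self (pow_ne_zero _ p0), sub_self, zero_mul, zero_mul, sub_zero] at tel
    have e1 := qPoch_succ p p N
    have e2 := qPoch_succ D p N
    have e3 := qPoch_succ E p N
    have e4 := qPoch_succ z p N
    have eD : A * p ^ (N + 1) / B = D * p ^ N := by rw [hBD]; ring
    have eE : A * p ^ (N + 1) / C = E * p ^ N := by rw [hCE]; ring
    have ez : A * p ^ (N + 1) / (B * C) = z * p ^ N := by rw [hz]; ring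
    -- The two factors of the bracket that depend on k turn the level N + 1 term into the level N
    -- term.
    have step : ∀ k ∈ Finset.range (N + 1), wpTerm p A B C D E z (N + 1) k *
        ((1 - p ^ (N + 1) / p ^ k) * (1 - A * p ^ (N + 1) * p ^ k)) =
        wpTerm p A B C D E z N k := by
      intro k hk
      obtain ⟨l, hl⟩ := Nat.exists_eq_add_of_le (Nat.lt_succ_iff.1 (Finset.mem_range.1 hk))
      have n4 := qPoch_ne_zero_of_le (show l + 1 ≤ N + 1 by omega) hp
      have n5 := qPoch_ne_zero_of_le (show N + k + 1 ≤ 2 * (N + 1) by omega) hA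
      rw [qPoch_succ] at n4 n5
      obtain ⟨a4, b4⟩ := mul_ne_zero_iff.1 n4
      obtain ⟨a5, b5⟩ := mul_ne_zero_iff.1 n5
      have h1 : p ^ (N + 1) / p ^ k = p * p ^ l := by
        rw [hl, show k + l + 1 = k + (l + 1) by ring, pow_add,
          mul_div_cancel_left₀ _ (pow_ne_zero _ p0)]
        ring
      have h2 : A * p ^ (N + 1) * p ^ k = A * p * p ^ (N + k) := by ring
      rw [h1, h2]
      unfold wpTerm
      rw [show N + 1 - k = l + 1 by omega, show N - k = l by omega,
        show N + 1 + k = N + k + 1 by ring, qPoch_succ p p l, qPoch_succ (A * p)]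
      rw [div_mul_eq_mul_div, ← mul_div_mul_right (qPoch A p k * qPoch B p k * qPoch C p k *
        (-z) ^ k * p ^ k.choose 2) _ (mul_ne_zero b4 b5)]
      congr 1
      ring
    have hsum : ∑ k ∈ Finset.range (N + 1), wpTerm p A B C D E z (N + 1) k *
        ((1 - A * p ^ (2 * k)) * ((1 - p ^ (N + 1)) * (1 - A * p ^ (N + 1) / B) *
          (1 - A * p ^ (N + 1) / C) - (1 - p ^ (N + 1) / p ^ k) * (1 - A * p ^ (N + 1) * p ^ k) *
            (1 - A * p ^ (N + 1) / (B * C)))) =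
        (1 - p ^ (N + 1)) * (1 - D * p ^ N) * (1 - E * p ^ N) *
          ∑ k ∈ Finset.range (N + 1), (1 - A * p ^ (2 * k)) * wpTerm p A B C D E z (N + 1) k -
        (1 - z * p ^ N) * ∑ k ∈ Finset.range (N + 1), (1 - A * p ^ (2 * k)) *
          wpTerm p A B C D E z N k := by
      rw [Finset.mul_sum, Finset.mul_sum, ← Finset.sum_sub_distrib]
      refine Finset.sum_congr rfl fun k hk => ?_
      rw [← step k hk, eD, eE, ez]
      ring
    rw [hsum, ih, eD, eE] at tel
    rw [Finset.sum_range_succ]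
    rw [e1] at hp ⊢
    rw [e2] at hD ⊢
    rw [e3] at hE ⊢
    rw [e4]
    obtain ⟨a1, b1⟩ := mul_ne_zero_iff.1 hp
    obtain ⟨a2, b2⟩ := mul_ne_zero_iff.1 hD
    obtain ⟨a3, b3⟩ := mul_ne_zero_iff.1 hE
    have e5 : p ^ (N + 1) = p * p ^ N := by ring
    rw [e5] at tel
    clear hBD hCE hz e1 e2 e3 e4 e5 ih step hsum eD eE ez
    have e6 : (1 - A) * qPoch z p N / (qPoch p p N * qPoch D p N * qPoch E p N) *
      (qPoch p p N * qPoch D p N * qPoch E p N) = (1 - A) * qPoch z p N :=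
      div_mul_cancel₀ _ (by simp [*])
    rw [eq_div_iff (by simp [*])]
    linear_combination (qPoch p p N * qPoch D p N * qPoch E p N) * tel + (1 - z * p ^ N) * e6

end wellPoised

end QDouble
namespace QDouble

/-! ### Evaluations with the terminating parameter q^(1-n) -/

section evaluation

variable {F : Type*} [Field F]

/-- Each factor equals -q^(2i+1) (1 - q^(2(M-i))), so the product peels off the top k factors of
(q²;q²)_M. -/
theorem prod_sub_odd_mul_qPoch (q : F) {M k : ℕ} (hk : k ≤ M) :
    (∏ i ∈ Finset.range k, (q ^ (2 * M + 1) - q ^ (2 * i + 1))) * qPoch (q ^ 2) (q ^ 2) (M - k) =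
      (-1) ^ k * q ^ (k ^ 2) * qPoch (q ^ 2) (q ^ 2) M := by
  induction k with
  | zero => simp
  | succ k ih =>
    obtain ⟨l, rfl⟩ := Nat.exists_eq_add_of_le hk
    have ih := ih (by omega)
    rw [show k + 1 + l - k = l + 1 by omega, qPoch_succ] at ih
    rw [show k + 1 + l - (k + 1) = l by omega, Finset.prod_range_succ]
    have h : q ^ (2 * (k + 1 + l) + 1) - q ^ (2 * k + 1) =
      - q ^ (2 * k + 1) * (1 - q ^ 2 * (q ^ 2) ^ l) := by ring
    rw [h]
    linear_combination (- q ^ (2 * k + 1)) * ih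

theorem prod_sub_even_mul_qPoch (q : F) {M k : ℕ} (hk : k ≤ M) :
    (∏ i ∈ Finset.range k, (q ^ (2 * M + 1) - q ^ (2 * i + 2))) * qPoch q (q ^ 2) (M - k) =
      (-1) ^ k * q ^ (k * (k + 1)) * qPoch q (q ^ 2) M := by
  induction k with
  | zero => simp
  | succ k ih =>
    obtain ⟨l, rfl⟩ := Nat.exists_eq_add_of_le hk
    have ih := ih (by omega)
    rw [show k + 1 + l - k = l + 1 by omega, qPoch_succ] at ih
    rw [show k + 1 + l - (k + 1) = l by omega, Finset.prod_range_succ]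
    have h : q ^ (2 * (k + 1 + l) + 1) - q ^ (2 * k + 2) =
      - q ^ (2 * k + 2) * (1 - q * (q ^ 2) ^ l) := by ring
    rw [h]
    linear_combination (- q ^ (2 * k + 2)) * ih

theorem prod_sub_eq_qPoch {a : F} (ha : a ≠ 0) (q y : F) (k : ℕ) :
    ∏ i ∈ Finset.range k, (a - y * q ^ i) = a ^ k * qPoch (y / a) q k := by
  induction k with
  | zero => simp [qPoch_zero]
  | succ k ih =>
    rw [Finset.prod_range_succ, ih, qPoch_succ]
    field_simp
    ring

theorem qPoch_cube (q : F) (M : ℕ) :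
    (1 - q) * qPoch (q ^ 3) (q ^ 2) M = qPoch q (q ^ 2) M * (1 - q ^ (2 * M + 1)) := by
  have h1 := qPoch_one_add q (q ^ 2) M
  rw [add_comm, qPoch_succ, show q * q ^ 2 = q ^ 3 by ring] at h1
  rw [← h1]
  ring

/-- The terminating very-well-poised `₆φ₅` sum with base `q²`, one of whose parameters is
`q ^ (1 - n)`, where `n = 2 M + 1`. -/
theorem sum_wellPoised {q b c : F} (M : ℕ) (hq : ∀ i, q ^ (i + 1) ≠ 1) (q0 : q ≠ 0)
    (hb : b ≠ 0) (hc : c ≠ 0) (hD : qPoch (q ^ 2 / b) (q ^ 2) M ≠ 0)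
    (hE : qPoch (q ^ 2 / c) (q ^ 2) M ≠ 0) :
    ∑ k ∈ Finset.range (M + 1), qInt q (4 * k + 1) *
        (qPoch q (q ^ 2) k * qPoch (q * b) (q ^ 2) k * qPoch (q * c) (q ^ 2) k *
          (∏ i ∈ Finset.range k, (q ^ (2 * M + 1) - q ^ (2 * i + 1))) /
          (qPoch (q ^ 2) (q ^ 2) k * qPoch (q ^ 2 / b) (q ^ 2) k * qPoch (q ^ 2 / c) (q ^ 2) k *
            qPoch (q ^ (2 * M + 3)) (q ^ 2) k) / (b * c) ^ k) =
      qInt q (2 * M + 1) * qPoch q (q ^ 2) M * qPoch (q / (b * c)) (q ^ 2) M /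
        (qPoch (q ^ 2 / b) (q ^ 2) M * qPoch (q ^ 2 / c) (q ^ 2) M) := by
  have hp : ∀ N, qPoch (q ^ 2) (q ^ 2) N ≠ 0 := fun N => qPoch_ne_zero_iff.2 fun i _ => by
    have := hq (2 * i + 1)
    rw [sub_ne_zero]
    intro h
    exact this (by rw [h]; ring)
  have hA : ∀ N, qPoch (q * q ^ 2) (q ^ 2) N ≠ 0 := fun N => qPoch_ne_zero_iff.2 fun i _ => by
    have := hq (2 * i + 2)
    rw [sub_ne_zero]
    intro h
    exact this (by rw [h]; ring)
  have q1 : 1 - q ≠ 0 := sub_ne_zero.2 fun h => hq 0 (by rw [← h]; ring)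
  -- The terminating parameter p^(-M) is q^(1-n), and q^(nk) (q^(1-n);q²)_k is the product of the
  -- differences q^n - q^(2i+1).
  have main := sum_wpTerm (p := q ^ 2) (A := q) (B := q * b) (C := q * c) (D := q ^ 2 / b)
    (E := q ^ 2 / c) (z := q / (b * c)) M (pow_ne_zero _ q0) (mul_ne_zero q0 hb)
    (mul_ne_zero q0 hc) (by field_simp) (by field_simp) (by field_simp) (hp M) hD hE (hA _)
  have term : ∀ k ∈ Finset.range (M + 1), (1 - q) * (qInt q (4 * k + 1) *
        (qPoch q (q ^ 2) k * qPoch (q * b) (q ^ 2) k * qPoch (q * c) (q ^ 2) k *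
          (∏ i ∈ Finset.range k, (q ^ (2 * M + 1) - q ^ (2 * i + 1))) /
          (qPoch (q ^ 2) (q ^ 2) k * qPoch (q ^ 2 / b) (q ^ 2) k * qPoch (q ^ 2 / c) (q ^ 2) k *
            qPoch (q ^ (2 * M + 3)) (q ^ 2) k) / (b * c) ^ k)) =
      (qPoch (q ^ 2) (q ^ 2) M * qPoch (q ^ 3) (q ^ 2) M) * ((1 - q * (q ^ 2) ^ (2 * k)) *
        wpTerm (q ^ 2) q (q * b) (q * c) (q ^ 2 / b) (q ^ 2 / c) (q / (b * c)) M k) := by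
    intro k hk
    have hk : k ≤ M := Nat.lt_succ_iff.1 (Finset.mem_range.1 hk)
    have h1 := prod_sub_odd_mul_qPoch q hk
    have h2 : qPoch (q * q ^ 2) (q ^ 2) (M + k) =
        qPoch (q ^ 3) (q ^ 2) M * qPoch (q ^ (2 * M + 3)) (q ^ 2) k := by
      rw [qPoch_add, show q * q ^ 2 = q ^ 3 by ring,
        show q ^ 3 * (q ^ 2) ^ M = q ^ (2 * M + 3) by ring]
    have h3 := hA (M + k)
    rw [h2] at h3
    obtain ⟨h3, h4⟩ := mul_ne_zero_iff.1 h3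
    rw [← mul_assoc, one_sub_mul_qInt, ← eq_div_iff (hp _)] at *
    have h5 : (-(q / (b * c))) ^ k * (q ^ 2) ^ k.choose 2 = (-1) ^ k * q ^ k ^ 2 / (b * c) ^ k := by
      have : k ^ 2 = k + 2 * k.choose 2 := by
        have := Nat.choose_two_right k
        have h := Nat.div_mul_cancel (Nat.even_mul_pred_self k).two_dvd
        rw [← this] at h
        cases k with
        | zero => rfl
        | succ k => simp only [Nat.add_sub_cancel] at h; nlinarith
      rw [this, ← pow_mul, pow_add, neg_pow, div_pow]
      ring
    have h6 : wpTerm (q ^ 2) q (q * b) (q * c) (q ^ 2 / b) (q ^ 2 / c) (q / (b * c)) M k =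
        qPoch q (q ^ 2) k * qPoch (q * b) (q ^ 2) k * qPoch (q * c) (q ^ 2) k *
          ((-1) ^ k * q ^ k ^ 2 / (b * c) ^ k) /
          (qPoch (q ^ 2) (q ^ 2) k * qPoch (q ^ 2 / b) (q ^ 2) k * qPoch (q ^ 2 / c) (q ^ 2) k *
            qPoch (q ^ 2) (q ^ 2) (M - k) *
              (qPoch (q ^ 3) (q ^ 2) M * qPoch (q ^ (2 * M + 3)) (q ^ 2) k)) := by
      rw [wpTerm, h2, ← h5]
      ring
    rw [h6, h1, show q ^ (4 * k + 1) = q * (q ^ 2) ^ (2 * k) by ring]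
    have := qPoch_ne_zero_of_le hk hD
    have := qPoch_ne_zero_of_le hk hE
    have := hp k
    have := hp (M - k)
    field_simp
  refine mul_left_cancel₀ q1 ?_
  rw [Finset.mul_sum, Finset.sum_congr rfl term, ← Finset.mul_sum, main]
  have h1 := qPoch_cube q M
  rw [← one_sub_mul_qInt q (2 * M + 1)] at h1
  replace h1 : qPoch (q ^ 3) (q ^ 2) M = qPoch q (q ^ 2) M * qInt q (2 * M + 1) :=
    mul_left_cancel₀ q1 (by linear_combination h1)
  have := hp M
  field_simp
  linear_combination qPoch (q / (b * c)) (q ^ 2) M * h1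

theorem lam_inv (a q : F) (k : ℕ) : lam a⁻¹ q k = lam a q k := by
  unfold lam
  rw [div_inv_eq_mul, div_inv_eq_mul, inv_mul_eq_div, inv_mul_eq_div, mul_comm q a,
    mul_comm (q ^ 2) a, mul_comm (qPoch (q / a) (q ^ 2) k), mul_comm (qPoch (a * q ^ 2) (q ^ 2) k)]

/-- At a = q^n the factor (q/a;q²)_k of λ is itself the terminating one, so the ₆φ₅ sum applies with
b = 1 and c = a. -/
theorem sum_lam_pow {q : F} (M : ℕ) (hq : ∀ i, q ^ (i + 1) ≠ 1) (q0 : q ≠ 0) :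
    q ^ M * ∑ k ∈ Finset.range (M + 1), lam (q ^ (2 * M + 1)) q k = qInt q (2 * M + 1) := by
  have hp : ∀ N, qPoch (q ^ 2) (q ^ 2) N ≠ 0 := fun N => qPoch_ne_zero_iff.2 fun i _ => by
    have := hq (2 * i + 1)
    rw [sub_ne_zero]
    intro h
    exact this (by rw [h]; ring)
  have ho : ∀ N, qPoch q (q ^ 2) N ≠ 0 := fun N => qPoch_ne_zero_iff.2 fun i _ => by
    have := hq (2 * i)
    rw [sub_ne_zero]
    intro h
    exact this (by rw [h]; ring)
  set a := q ^ (2 * M + 1) with ha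
  have a0 : a ≠ 0 := pow_ne_zero _ q0
  have e1 := prod_sub_odd_mul_qPoch q (le_refl M)
  have e2 := prod_sub_even_mul_qPoch q (le_refl M)
  have p1 : ∀ k, ∏ i ∈ Finset.range k, (a - q ^ (2 * i + 1)) = a ^ k * qPoch (q / a) (q ^ 2) k :=
    fun k => by
      rw [← prod_sub_eq_qPoch a0]
      exact Finset.prod_congr rfl fun i _ => by ring
  have p2 : ∀ k, ∏ i ∈ Finset.range k, (a - q ^ (2 * i + 2)) =
      a ^ k * qPoch (q ^ 2 / a) (q ^ 2) k := fun k => by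
    rw [← prod_sub_eq_qPoch a0]
    exact Finset.prod_congr rfl fun i _ => by ring
  rw [← ha, Nat.sub_self, qPoch_zero, mul_one, p1] at e1
  rw [← ha, Nat.sub_self, qPoch_zero, mul_one, p2] at e2
  have hE : qPoch (q ^ 2 / a) (q ^ 2) M ≠ 0 := by
    intro h
    rw [h, mul_zero] at e2
    exact mul_ne_zero (mul_ne_zero (pow_ne_zero _ (neg_ne_zero.2 one_ne_zero))
      (pow_ne_zero _ q0)) (ho M) e2.symm
  have main := sum_wellPoised (b := 1) M hq q0 one_ne_zero a0 (by simpa using hp M) hE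
  simp only [← ha, div_one, mul_one, one_mul] at main
  have term : ∀ k ∈ Finset.range (M + 1), lam a q k = qInt q (4 * k + 1) *
      (qPoch q (q ^ 2) k * qPoch q (q ^ 2) k * qPoch (q * a) (q ^ 2) k *
          (∏ i ∈ Finset.range k, (a - q ^ (2 * i + 1))) /
          (qPoch (q ^ 2) (q ^ 2) k * qPoch (q ^ 2) (q ^ 2) k * qPoch (q ^ 2 / a) (q ^ 2) k *
            qPoch (q ^ (2 * M + 3)) (q ^ 2) k) / a ^ k) := fun k _ => by
    rw [p1, lam, show q ^ (2 * M + 3) = a * q ^ 2 by rw [ha]; ring, mul_comm q a]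
    have := pow_ne_zero k a0
    field_simp
  rw [Finset.sum_congr rfl term, main]
  have := hp M
  have key : q ^ M * (qPoch q (q ^ 2) M * qPoch (q / a) (q ^ 2) M) =
      qPoch (q ^ 2) (q ^ 2) M * qPoch (q ^ 2 / a) (q ^ 2) M := by
    refine mul_left_cancel₀ (pow_ne_zero M a0) ?_
    linear_combination (q ^ M * qPoch q (q ^ 2) M) * e1 - qPoch (q ^ 2) (q ^ 2) M * e2
  field_simp
  linear_combination qInt q (2 * M + 1) * key

end evaluation

end QDouble
namespace QDouble

/-! ### Antisymmetries at a primitive root of unity -/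

section rootOfUnity

variable {F : Type*} [Field F]

/-- Here x ≡ -y mod n, so x² ≡ y². -/
theorem pow_sq_eq_of_add {q : F} {x y n : ℕ} (h : x + y = n) (hq : q ^ n = 1) :
    q ^ x ^ 2 = q ^ y ^ 2 := by
  have h1 : q ^ x ^ 2 * q ^ (x * y) = 1 := by
    rw [← pow_add, show x ^ 2 + x * y = n * x by rw [← h]; ring, pow_mul, hq, one_pow]
  have h2 : q ^ y ^ 2 * q ^ (x * y) = 1 := by
    rw [← pow_add, show y ^ 2 + x * y = n * y by rw [← h]; ring, pow_mul, hq, one_pow]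
  refine mul_right_cancel₀ (fun h0 => ?_) (h1.trans h2.symm)
  rw [h0, mul_zero] at h1
  exact zero_ne_one h1

theorem qInt_mul_pow_antisymm {q : F} {k m M : ℕ} (h : k + m = M) (hq : q ^ (2 * M + 1) = 1)
    (q1 : q ≠ 1) : qInt q (4 * m + 1) * q ^ (4 * m ^ 2) = -(qInt q (4 * k + 1) * q ^ (4 * k ^ 2)) := by
  have e1 := pow_sq_eq_of_add (show (2 * m + 1) + 2 * k = 2 * M + 1 by omega) hq
  have e2 := pow_sq_eq_of_add (show (2 * k + 1) + 2 * m = 2 * M + 1 by omega) hq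
  refine mul_left_cancel₀ (sub_ne_zero.2 q1.symm) ?_
  rw [← mul_assoc, one_sub_mul_qInt, mul_neg, ← mul_assoc, one_sub_mul_qInt]
  rw [show (2 * m + 1) ^ 2 = 4 * m + 1 + 4 * m ^ 2 by ring, mul_pow, pow_add] at e1
  rw [show (2 * k + 1) ^ 2 = 4 * k + 1 + 4 * k ^ 2 by ring, mul_pow, pow_add] at e2
  norm_num at e1 e2
  linear_combination - e1 - e2

theorem qInt_mul_pow_antisymm' {q : F} {r s M : ℕ} (h : r + s + 1 = M) (hq : q ^ (2 * M + 1) = 1)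
    (q1 : q ≠ 1) : qInt q (4 * s + 3) * q ^ (4 * (r + 1) ^ 2) =
      -(qInt q (4 * r + 3) * q ^ (4 * (s + 1) ^ 2)) := by
  have e1 := pow_sq_eq_of_add (show (2 * r + 1) + 2 * (s + 1) = 2 * M + 1 by omega) hq
  have e2 := pow_sq_eq_of_add (show (2 * s + 1) + 2 * (r + 1) = 2 * M + 1 by omega) hq
  refine mul_left_cancel₀ (sub_ne_zero.2 q1.symm) ?_
  rw [← mul_assoc, one_sub_mul_qInt, mul_neg, ← mul_assoc, one_sub_mul_qInt]
  rw [mul_pow] at e1 e2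
  norm_num at e1 e2
  have e3 : q ^ (4 * r + 3) * q ^ (2 * r + 1) ^ 2 = q ^ (4 * (r + 1) ^ 2) := by ring
  have e4 : q ^ (4 * s + 3) * q ^ (2 * s + 1) ^ 2 = q ^ (4 * (s + 1) ^ 2) := by ring
  rw [← e1, ← e2] at *
  linear_combination - e3 - e4

/-- Since q^n = 1, the last m factors of (q²y;q²)_M, read backwards, are those of (q/y;q²)_m up to
powers of q and -y. -/
theorem qPoch_reverse {q y : F} (hy : y ≠ 0) {k m M : ℕ} (h : k + m = M)
    (hq : q ^ (2 * M + 1) = 1) :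
    qPoch (q ^ 2 * y) (q ^ 2) M * q ^ m ^ 2 =
      qPoch (q ^ 2 * y) (q ^ 2) k * (-y) ^ m * qPoch (q / y) (q ^ 2) m := by
  induction m generalizing k with
  | zero => simp [← h, qPoch_zero]
  | succ m ih =>
    have ih := ih (k := k + 1) (by omega)
    rw [qPoch_succ] at ih
    rw [qPoch_succ, show (m + 1) ^ 2 = m ^ 2 + (2 * m + 1) by ring, pow_add, ← mul_assoc, ih]
    have : q ^ (2 * m + 1) * q ^ (2 * (k + 1)) = 1 := by
      rw [← pow_add, show 2 * m + 1 + 2 * (k + 1) = 2 * M + 1 by omega, hq]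
    have h2 : (1 - q ^ 2 * y * (q ^ 2) ^ k) * q ^ (2 * m + 1) =
        -y * (1 - q / y * (q ^ 2) ^ m) := by
      have : -y * (1 - q / y * (q ^ 2) ^ m) = -y + q * (q ^ 2) ^ m := by field_simp; ring
      rw [this]
      linear_combination - y * ‹q ^ (2 * m + 1) * q ^ (2 * (k + 1)) = 1›
    rw [pow_succ (-y)]
    linear_combination qPoch (q ^ 2 * y) (q ^ 2) k * (-y) ^ m * qPoch (q / y) (q ^ 2) m * h2

variable {q a : F} {M : ℕ}

theorem one_sub_div_ne_zero (hq : q ^ (2 * M + 1) = 1) (ha : ∀ i, a * q ^ i ≠ 1) (a0 : a ≠ 0)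
    (i : ℕ) : 1 - q ^ i / a ≠ 0 := fun h => by
  rw [sub_eq_zero, eq_div_iff a0, one_mul] at h
  -- When a = q^i, its inverse is q^(2Mi) because q^(2M+1) = 1.
  refine ha (i * (2 * M)) ?_
  rw [h, ← pow_add, show i + i * (2 * M) = (2 * M + 1) * i by ring, pow_mul, hq, one_pow]

theorem qPoch_mul_pow_ne_zero (ha : ∀ i, a * q ^ i ≠ 1) (i k : ℕ) :
    qPoch (a * q ^ i) (q ^ 2) k ≠ 0 := qPoch_ne_zero_iff.2 fun j _ => by
  rw [sub_ne_zero, ← pow_mul, mul_assoc, ← pow_add]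
  exact (ha _).symm

theorem qPoch_div_ne_zero (hq : q ^ (2 * M + 1) = 1) (ha : ∀ i, a * q ^ i ≠ 1) (a0 : a ≠ 0)
    (i k : ℕ) : qPoch (q ^ i / a) (q ^ 2) k ≠ 0 := qPoch_ne_zero_iff.2 fun j _ => by
  have := one_sub_div_ne_zero hq ha a0 (i + 2 * j)
  rwa [pow_add, pow_mul, mul_div_right_comm] at this

theorem qPoch_sq_ne_zero (hq : IsPrimitiveRoot q (2 * M + 1)) {k : ℕ} (hk : k < 2 * M + 1) :
    qPoch (q ^ 2) (q ^ 2) k ≠ 0 := qPoch_ne_zero_iff.2 fun j hj => by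
  rw [sub_ne_zero, ← pow_mul, ← pow_add, ne_comm, Ne, hq.pow_eq_one_iff_dvd]
  intro h
  have h2 : 2 * M + 1 ∣ j + 1 :=
    (Nat.Coprime.dvd_mul_left (m := 2) (by simp)).1 (by convert h using 1; ring)
  have := Nat.le_of_dvd (by omega) h2
  omega

theorem qPoch_self_ne_zero (hq : IsPrimitiveRoot q (2 * M + 1)) {k : ℕ} (hk : k ≤ M) :
    qPoch q (q ^ 2) k ≠ 0 := qPoch_ne_zero_iff.2 fun j hj => by
  rw [sub_ne_zero, ← pow_mul, ← pow_succ', ne_comm]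
  exact hq.pow_ne_one_of_pos_of_lt (by omega) (by omega)

/-- The numerator of `lam` without its factor `[4k+1]`. -/
def lamNum (a q : F) (k : ℕ) : F :=
  qPoch q (q ^ 2) k ^ 2 * (qPoch (a * q) (q ^ 2) k * qPoch (q / a) (q ^ 2) k)

/-- The denominator of `lam`. -/
def lamDen (a q : F) (k : ℕ) : F :=
  qPoch (q ^ 2) (q ^ 2) k ^ 2 * (qPoch (q ^ 2 / a) (q ^ 2) k * qPoch (a * q ^ 2) (q ^ 2) k)

theorem lam_eq (a q : F) (k : ℕ) : lam a q k = qInt q (4 * k + 1) * (lamNum a q k / lamDen a q k) :=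
  rfl

theorem lamNum_ne_zero (hq : IsPrimitiveRoot q (2 * M + 1)) (ha : ∀ i, a * q ^ i ≠ 1) (a0 : a ≠ 0)
    {k : ℕ} (hk : k ≤ M) : lamNum a q k ≠ 0 := by
  have h1 := qPoch_mul_pow_ne_zero ha 1 k
  have h2 := qPoch_div_ne_zero hq.pow_eq_one ha a0 1 k
  rw [pow_one] at h1 h2
  exact mul_ne_zero (pow_ne_zero _ (qPoch_self_ne_zero hq hk)) (mul_ne_zero h1 h2)

theorem lamDen_ne_zero (hq : IsPrimitiveRoot q (2 * M + 1)) (ha : ∀ i, a * q ^ i ≠ 1) (a0 : a ≠ 0)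
    {k : ℕ} (hk : k < 2 * M + 1) : lamDen a q k ≠ 0 :=
  mul_ne_zero (pow_ne_zero _ (qPoch_sq_ne_zero hq hk))
    (mul_ne_zero (qPoch_div_ne_zero hq.pow_eq_one ha a0 2 k) (qPoch_mul_pow_ne_zero ha 2 k))

/-- Reversal at y = 1, a and 1/a exchanges numerators and denominators of λ; the signs and powers of
a cancel. -/
theorem lamDen_mul_lamNum (hq : q ^ (2 * M + 1) = 1) (a0 : a ≠ 0) {k m : ℕ} (h : k + m = M) :
    lamDen a q k * lamNum a q m = lamDen a q M * q ^ (4 * m ^ 2) := by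
  have e1 := qPoch_reverse one_ne_zero h hq
  have e2 := qPoch_reverse a0 h hq
  have e3 := qPoch_reverse (inv_ne_zero a0) h hq
  have s1 : ((-1 : F) ^ m) ^ 2 = 1 := by rw [← pow_mul, mul_comm, pow_mul]; simp
  have s2 : (-a) ^ m * (-a⁻¹) ^ m = 1 := by rw [← mul_pow]; simp [a0]
  rw [mul_one, div_one] at e1
  rw [mul_comm (q ^ 2) a] at e2
  rw [div_inv_eq_mul, mul_comm q a, ← div_eq_mul_inv] at e3
  unfold lamDen lamNum
  have : q ^ (4 * m ^ 2) = (q ^ m ^ 2) ^ 2 * q ^ m ^ 2 * q ^ m ^ 2 := by ring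
  rw [this]
  generalize (-1 : F) ^ m = s at *
  generalize (-a) ^ m = t at *
  generalize (-a⁻¹) ^ m = u at *
  calc _ = (qPoch (q ^ 2) (q ^ 2) k * s * qPoch q (q ^ 2) m) ^ 2 *
        (qPoch (a * q ^ 2) (q ^ 2) k * t * qPoch (q / a) (q ^ 2) m) *
        (qPoch (q ^ 2 / a) (q ^ 2) k * u * qPoch (a * q) (q ^ 2) m) := by
        linear_combination (-(qPoch (q ^ 2) (q ^ 2) k * qPoch q (q ^ 2) m) ^ 2 *
        (qPoch (a * q ^ 2) (q ^ 2) k * qPoch (q / a) (q ^ 2) m) *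
        (qPoch (q ^ 2 / a) (q ^ 2) k * qPoch (a * q) (q ^ 2) m)) * (t * u * s1 + s2)
    _ = _ := by rw [← e1, ← e2, ← e3]; ring

/-- Reversal yields the ratio q^(4m² - 4k²) apart from the q-integers, and `qInt_mul_pow_antisymm`
turns that into the sign. M ≠ 0 ensures q ≠ 1. -/
theorem lam_antisymm (hM : M ≠ 0) (hq : IsPrimitiveRoot q (2 * M + 1)) (ha : ∀ i, a * q ^ i ≠ 1) (a0 : a ≠ 0)
    {k m : ℕ} (h : k + m = M) : lam a q m = -lam a q k := by
  have q1 : q ≠ 1 := hq.ne_one (by omega)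
  have e1 := lamDen_mul_lamNum hq.pow_eq_one a0 h
  have e2 := lamDen_mul_lamNum hq.pow_eq_one a0 (show m + k = M by omega)
  have e3 := qInt_mul_pow_antisymm h hq.pow_eq_one q1
  have d1 := lamDen_ne_zero hq ha a0 (show k < 2 * M + 1 by omega)
  have d2 := lamDen_ne_zero hq ha a0 (show m < 2 * M + 1 by omega)
  rw [lam_eq, lam_eq, mul_div_assoc', mul_div_assoc', ← neg_div, div_eq_div_iff d2 d1]
  linear_combination qInt q (4 * m + 1) * e1 + qInt q (4 * k + 1) * e2 + lamDen a q M * e3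

theorem sum_lam_eq_zero [CharZero F] (hM : M ≠ 0) (hq : IsPrimitiveRoot q (2 * M + 1))
    (ha : ∀ i, a * q ^ i ≠ 1) (a0 : a ≠ 0) : ∑ k ∈ Finset.range (M + 1), lam a q k = 0 := by
  rw [← self_eq_neg, ← Finset.sum_neg_distrib, ← Finset.sum_range_reflect]
  refine Finset.sum_congr rfl fun k hk => ?_
  have := Finset.mem_range.1 hk
  exact lam_antisymm hM hq ha a0 (by omega)

theorem lam_eq_zero {a q : F} {M k : ℕ} (hq : q ^ (2 * M + 1) = 1) (hk : M < k) :
    lam a q k = 0 := by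
  rw [lam_eq, lamNum, qPoch_eq_zero hk (by rw [← pow_mul, ← pow_succ', hq])]
  simp

theorem sum_lam_eq_sum_lam [CharZero F] (hM : M ≠ 0) (hq : IsPrimitiveRoot q (2 * M + 1))
    (ha : ∀ i, a * q ^ i ≠ 1) (a0 : a ≠ 0) {r m : ℕ} (h : m + r = M) :
    ∑ k ∈ Finset.range m, lam a q k = ∑ k ∈ Finset.range (r + 1), lam a q k := by
  induction r generalizing m with
  | zero =>
    have := sum_lam_eq_zero hM hq ha a0
    have h2 := lam_antisymm hM hq ha a0 (show 0 + M = M by omega)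
    rw [Finset.sum_range_succ, h2] at this
    obtain rfl : m = M := by omega
    rw [Finset.sum_range_one]
    linear_combination this
  | succ r ih =>
    have ih := ih (m := m + 1) (by omega)
    have h2 := lam_antisymm hM hq ha a0 h
    rw [Finset.sum_range_succ] at ih
    rw [Finset.sum_range_succ, ← ih, h2]
    ring

/-- `lam a q (M + 1 + r) / (1 - q ^ (2 * M + 1)) ^ 2`, written without the vanishing factors. -/
def lamTail (a q : F) (M r : ℕ) : F :=
  qInt q (4 * (M + 1 + r) + 1) *
    (((qPoch q (q ^ 2) M * qPoch (q ^ (2 * M + 3)) (q ^ 2) r) ^ 2 *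
      (qPoch (a * q) (q ^ 2) (M + 1 + r) * qPoch (q / a) (q ^ 2) (M + 1 + r))) /
        lamDen a q (M + 1 + r))

theorem lam_eq_lamTail (a q : F) (M r : ℕ) :
    lam a q (M + 1 + r) = (1 - q ^ (2 * M + 1)) ^ 2 * lamTail a q M r := by
  rw [lam_eq, lamTail, lamNum, qPoch_add q, qPoch_succ q,
    show q * (q ^ 2) ^ M = q ^ (2 * M + 1) by ring,
    show q * (q ^ 2) ^ (M + 1) = q ^ (2 * M + 3) by ring]
  ring

theorem qInt_congr {q : F} {n : ℕ} (hq : q ^ n = 1) (q1 : q ≠ 1) (m k : ℕ) :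
    qInt q (n * k + m) = qInt q m := by
  refine mul_left_cancel₀ (sub_ne_zero.2 q1.symm) ?_
  rw [one_sub_mul_qInt, one_sub_mul_qInt, pow_add, pow_mul, hq, one_pow, one_mul]

theorem lamTail_mul (hq : IsPrimitiveRoot q (2 * M + 1)) (ha : ∀ i, a * q ^ i ≠ 1)
    (a0 : a ≠ 0) {r s : ℕ} (h : r + s + 1 = M) :
    lamTail a q M r * (lamNum a q (r + 1) * lamNum a q (s + 1)) =
      qPoch q (q ^ 2) M ^ 2 * (qPoch (a * q) (q ^ 2) (M + 1) * qPoch (q / a) (q ^ 2) (M + 1)) *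
        (qInt q (4 * r + 3) * q ^ (4 * (s + 1) ^ 2)) := by
  have q1 : q ≠ 1 := hq.ne_one (by omega)
  have hn := hq.pow_eq_one
  have e := lamDen_mul_lamNum hn a0 (show r + (s + 1) = M by omega)
  have d0 := lamDen_ne_zero hq ha a0 (show M < 2 * M + 1 by omega)
  have d1 := lamDen_ne_zero hq ha a0 (show M + 1 + r < 2 * M + 1 by omega)
  -- Past index M the factors of the denominator restart at exponent 1, as q^(2M+2) = q, and so
  -- become those of a numerator.
  have h1 : lamDen a q (M + 1 + r) = lamDen a q M * lamNum a q (r + 1) := by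
    have p2 : (q ^ 2) * (q ^ 2) ^ M = q := by
      rw [show (q ^ 2) * (q ^ 2) ^ M = q ^ (2 * M + 1) * q by ring, hn, one_mul]
    rw [lamDen, lamDen, lamNum, add_assoc, add_comm 1 r, qPoch_add (q ^ 2) _ M,
      qPoch_add (q ^ 2 / a) _ M, qPoch_add (a * q ^ 2) _ M, p2,
      div_mul_eq_mul_div, p2, mul_assoc a, p2]
    ring
  have h2 : ∀ y, qPoch y (q ^ 2) (M + 1 + r) = qPoch y (q ^ 2) (M + 1) * qPoch (y * q) (q ^ 2) r :=
    fun y => by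
      rw [qPoch_add, show (q ^ 2) ^ (M + 1) = q ^ (2 * M + 1) * q by ring, hn, one_mul]
  have h3 : qInt q (4 * (M + 1 + r) + 1) = qInt q (4 * r + 3) := by
    rw [show 4 * (M + 1 + r) + 1 = (2 * M + 1) * 2 + (4 * r + 3) by ring, qInt_congr hn q1]
  have h4 : q ^ (2 * M + 3) = q ^ 2 := by
    rw [show 2 * M + 3 = 2 * M + 1 + 2 by ring, pow_add, hn, one_mul]
  have h5 : (qPoch (q ^ 2) (q ^ 2) r) ^ 2 *
      (qPoch (a * q * q) (q ^ 2) r * qPoch (q / a * q) (q ^ 2) r) = lamDen a q r := by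
    rw [lamDen, mul_assoc a, ← sq, div_mul_eq_mul_div, ← sq, mul_comm (qPoch (a * _) _ _)]
  have n1 : lamNum a q (r + 1) ≠ 0 := lamNum_ne_zero hq ha a0 (by omega)
  rw [lamTail, h1, h2, h2 (q / a), h3, h4]
  rw [mul_div_assoc', div_mul_eq_mul_div, div_eq_iff (mul_ne_zero d0 n1)]
  rw [← h5] at e
  linear_combination qInt q (4 * r + 3) * qPoch q (q ^ 2) M ^ 2 *
    (qPoch (a * q) (q ^ 2) (M + 1) * qPoch (q / a) (q ^ 2) (M + 1)) * lamNum a q (r + 1) * e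

theorem lamTail_antisymm (hq : IsPrimitiveRoot q (2 * M + 1))
    (ha : ∀ i, a * q ^ i ≠ 1) (a0 : a ≠ 0) {r s : ℕ} (h : r + s + 1 = M) :
    lamTail a q M s = -lamTail a q M r := by
  have e1 := lamTail_mul hq ha a0 h
  have e2 := lamTail_mul hq ha a0 (show s + r + 1 = M by omega)
  have e3 := qInt_mul_pow_antisymm' h hq.pow_eq_one (hq.ne_one (by omega))
  have n1 : lamNum a q (r + 1) ≠ 0 := lamNum_ne_zero hq ha a0 (by omega)
  have n2 : lamNum a q (s + 1) ≠ 0 := lamNum_ne_zero hq ha a0 (by omega)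
  refine mul_right_cancel₀ (mul_ne_zero n1 n2) ?_
  linear_combination e1 + e2 + qPoch q (q ^ 2) M ^ 2 * (qPoch (a * q) (q ^ 2) (M + 1) *
    qPoch (q / a) (q ^ 2) (M + 1)) * e3

/-- Under r ↦ M - 1 - r the tail changes sign while the partial sum is unchanged, so the total is
its own negative. -/
theorem sum_lamTail_mul_sum_lam [CharZero F] (hM : M ≠ 0) (hq : IsPrimitiveRoot q (2 * M + 1))
    (ha : ∀ i, a * q ^ i ≠ 1) (a0 : a ≠ 0) :
    ∑ r ∈ Finset.range M, lamTail a q M r * ∑ k ∈ Finset.range (M - r), lam a q k = 0 := by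
  rw [← self_eq_neg, ← Finset.sum_neg_distrib, ← Finset.sum_range_reflect]
  refine Finset.sum_congr rfl fun r hr => ?_
  have hr := Finset.mem_range.1 hr
  rw [lamTail_antisymm hq ha a0 (show r + (M - 1 - r) + 1 = M by omega),
    show M - (M - 1 - r) = r + 1 by omega,
    sum_lam_eq_sum_lam hM hq ha a0 (show M - r + r = M by omega), neg_mul]

/-- The logarithmic derivative at `y = 1` of
`(q y; q²)_k (q²; q²)_k / ((q; q²)_k (q² / y; q²)_k y ^ k)`. -/
def logDeriv (q : F) (k : ℕ) : F :=
  -∑ i ∈ Finset.range k, (1 / (1 - q ^ (2 * i + 1)) + q ^ (2 * i + 2) / (1 - q ^ (2 * i + 2)))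

/-- The summands of index k and m cancel crosswise when q^(2m+1) q^(2k+2) = 1: 1/(1 - x) + y/(1 - y)
= 0 if xy = 1. -/
theorem logDeriv_reflect (hq : IsPrimitiveRoot q (2 * M + 1)) {k m : ℕ} (h : k + m = M) :
    logDeriv q m = logDeriv q M + logDeriv q k := by
  induction k generalizing m with
  | zero =>
    obtain rfl : m = M := by omega
    simp [logDeriv]
  | succ k ih =>
    have ih := ih (m := m + 1) (by omega)
    have hn := hq.pow_eq_one
    have h1 : q ^ (2 * m + 1) * q ^ (2 * k + 2) = 1 := by
      rw [← pow_add, show 2 * m + 1 + (2 * k + 2) = 2 * M + 1 by omega, hn]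
    have h2 : q ^ (2 * m + 2) * q ^ (2 * k + 1) = 1 := by
      rw [← pow_add, show 2 * m + 2 + (2 * k + 1) = 2 * M + 1 by omega, hn]
    have n1 := sub_ne_zero.2 (hq.pow_ne_one_of_pos_of_lt
      (show 2 * m + 1 ≠ 0 by omega) (by omega)).symm
    have n2 := sub_ne_zero.2 (hq.pow_ne_one_of_pos_of_lt
      (show 2 * m + 2 ≠ 0 by omega) (by omega)).symm
    have n3 := sub_ne_zero.2 (hq.pow_ne_one_of_pos_of_lt
      (show 2 * k + 1 ≠ 0 by omega) (by omega)).symm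
    have n4 := sub_ne_zero.2 (hq.pow_ne_one_of_pos_of_lt
      (show 2 * k + 2 ≠ 0 by omega) (by omega)).symm
    unfold logDeriv at *
    rw [Finset.sum_range_succ] at ih ⊢
    have e1 : 1 / (1 - q ^ (2 * m + 1)) + q ^ (2 * k + 2) / (1 - q ^ (2 * k + 2)) = 0 := by
      rw [div_add_div _ _ n1 n4, div_eq_zero_iff]
      left
      linear_combination - h1
    have e2 : 1 / (1 - q ^ (2 * k + 1)) + q ^ (2 * m + 2) / (1 - q ^ (2 * m + 2)) = 0 := by
      rw [div_add_div _ _ n3 n2, div_eq_zero_iff]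
      left
      linear_combination - h2
    linear_combination ih + e1 + e2

/-- Reflection sends L(k) to L(M) + L(k) and λ(k) to -λ(k); as ∑ λ = 0, the sum equals its negative.
-/
theorem sum_lam_mul_logDeriv [CharZero F] (hM : M ≠ 0) (hq : IsPrimitiveRoot q (2 * M + 1))
    (ha : ∀ i, a * q ^ i ≠ 1) (a0 : a ≠ 0) :
    ∑ k ∈ Finset.range (M + 1), lam a q k * logDeriv q k = 0 := by
  have h0 := sum_lam_eq_zero hM hq ha a0
  have : ∑ k ∈ Finset.range (M + 1), lam a q k * logDeriv q k =
      -(∑ k ∈ Finset.range (M + 1), lam a q k * logDeriv q k) := by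
    calc _ = -(logDeriv q M * ∑ k ∈ Finset.range (M + 1), lam a q k) -
          ∑ k ∈ Finset.range (M + 1), lam a q k * logDeriv q k := by
          rw [Finset.mul_sum, ← Finset.sum_neg_distrib, ← Finset.sum_sub_distrib,
            ← Finset.sum_range_reflect]
          refine Finset.sum_congr rfl fun k hk => ?_
          have hk := Finset.mem_range.1 hk
          rw [lam_antisymm hM hq ha a0 (show k + (M + 1 - 1 - k) = M by omega),
            logDeriv_reflect hq (show k + (M + 1 - 1 - k) = M by omega)]
          ring
      _ = _ := by rw [h0]; ring
  exact self_eq_neg.1 this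

theorem qPoch_self_pow_four (hq : q ^ (2 * M + 1) = 1) :
    qPoch q (q ^ 2) M ^ 4 = q * qPoch (q ^ 2) (q ^ 2) M ^ 4 := by
  have e := qPoch_reverse (y := (1 : F)) one_ne_zero (zero_add M) hq
  rw [qPoch_zero, mul_one, div_one, one_mul] at e
  have h1 : (q ^ M ^ 2) ^ 4 = q := by
    have h := pow_sq_eq_of_add (show 1 + 2 * M = 2 * M + 1 by omega) hq
    rw [show (2 * M) ^ 2 = M ^ 2 * 4 by ring, pow_mul, one_pow, pow_one] at h
    exact h.symm
  have h2 : ((-1 : F) ^ M) ^ 4 = 1 := by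
    rw [← pow_mul, mul_comm, pow_mul]
    norm_num
  have h3 := congrArg (· ^ 4) e
  simp only [mul_pow, h1, h2, one_mul] at h3
  rw [← h3]
  ring

end rootOfUnity

end QDouble
namespace QDouble

/-! ### Specialization of rational functions and congruences -/

section specialization

variable {κ : Type*} [Field κ]

/-- The rational function `x` is a fraction of polynomials whose denominator does not vanish under
the ring homomorphism `φ`, and `c` is its image under `φ`. -/
def Specializes (φ : PolyAQ →+* κ) (x : RatAQ) (c : κ) : Prop :=
  ∃ N D : PolyAQ, φ D ≠ 0 ∧ x = algebraMap PolyAQ RatAQ N / algebraMap PolyAQ RatAQ D ∧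
    c = φ N / φ D

theorem algebraMap_ne_zero_of_map {φ : PolyAQ →+* κ} {D : PolyAQ} (h : φ D ≠ 0) :
    algebraMap PolyAQ RatAQ D ≠ 0 := by
  intro h0
  rw [FaithfulSMul.algebraMap_eq_zero_iff] at h0
  exact h (by rw [h0, map_zero])

namespace Specializes

variable {φ : PolyAQ →+* κ} {x y : RatAQ} {c d : κ}

theorem algebraMap (N : PolyAQ) : Specializes φ (algebraMap PolyAQ RatAQ N) (φ N) :=
  ⟨N, 1, by simp, by simp, by simp⟩

theorem zero : Specializes φ 0 0 := by simpa using algebraMap (φ := φ) 0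

theorem one : Specializes φ 1 1 := by simpa using algebraMap (φ := φ) 1

theorem add (hx : Specializes φ x c) (hy : Specializes φ y d) : Specializes φ (x + y) (c + d) := by
  obtain ⟨N, D, h0, rfl, rfl⟩ := hx
  obtain ⟨N', D', h0', rfl, rfl⟩ := hy
  refine ⟨N * D' + D * N', D * D', by rw [map_mul]; exact mul_ne_zero h0 h0', ?_, ?_⟩
  · rw [div_add_div _ _ (algebraMap_ne_zero_of_map h0) (algebraMap_ne_zero_of_map h0')]
    simp only [map_add, map_mul]
  · rw [div_add_div _ _ h0 h0']
    simp only [map_add, map_mul]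

theorem neg (hx : Specializes φ x c) : Specializes φ (-x) (-c) := by
  obtain ⟨N, D, h0, rfl, rfl⟩ := hx
  exact ⟨-N, D, h0, by rw [map_neg, neg_div], by rw [map_neg, neg_div]⟩

theorem sub (hx : Specializes φ x c) (hy : Specializes φ y d) : Specializes φ (x - y) (c - d) := by
  rw [sub_eq_add_neg, sub_eq_add_neg]
  exact hx.add hy.neg

theorem mul (hx : Specializes φ x c) (hy : Specializes φ y d) : Specializes φ (x * y) (c * d) := by
  obtain ⟨N, D, h0, rfl, rfl⟩ := hx
  obtain ⟨N', D', h0', rfl, rfl⟩ := hy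
  exact ⟨N * N', D * D', by rw [map_mul]; exact mul_ne_zero h0 h0',
    by rw [div_mul_div_comm, map_mul, map_mul], by rw [div_mul_div_comm, map_mul, map_mul]⟩

theorem inv (hx : Specializes φ x c) (hc : c ≠ 0) : Specializes φ x⁻¹ c⁻¹ := by
  obtain ⟨N, D, h0, rfl, rfl⟩ := hx
  exact ⟨D, N, (div_ne_zero_iff.1 hc).1, by rw [inv_div], by rw [inv_div]⟩

theorem div (hx : Specializes φ x c) (hy : Specializes φ y d) (hd : d ≠ 0) :
    Specializes φ (x / y) (c / d) := by
  rw [div_eq_mul_inv, div_eq_mul_inv]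
  exact hx.mul (hy.inv hd)

theorem pow (hx : Specializes φ x c) (k : ℕ) : Specializes φ (x ^ k) (c ^ k) := by
  induction k with
  | zero => simpa using one
  | succ k ih => simpa only [pow_succ] using ih.mul hx

theorem sum {ι : Type*} {s : Finset ι} {f : ι → RatAQ} {g : ι → κ}
    (h : ∀ i ∈ s, Specializes φ (f i) (g i)) : Specializes φ (∑ i ∈ s, f i) (∑ i ∈ s, g i) := by
  classical
  induction s using Finset.induction_on with
  | empty => simpa using zero
  | insert i s hi ih =>
    rw [Finset.sum_insert hi, Finset.sum_insert hi]
    exact (h i (Finset.mem_insert_self i s)).add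
      (ih fun j hj => h j (Finset.mem_insert_of_mem hj))

theorem prod {ι : Type*} {s : Finset ι} {f : ι → RatAQ} {g : ι → κ}
    (h : ∀ i ∈ s, Specializes φ (f i) (g i)) : Specializes φ (∏ i ∈ s, f i) (∏ i ∈ s, g i) := by
  classical
  induction s using Finset.induction_on with
  | empty => simpa using one
  | insert i s hi ih =>
    rw [Finset.prod_insert hi, Finset.prod_insert hi]
    exact (h i (Finset.mem_insert_self i s)).mul
      (ih fun j hj => h j (Finset.mem_insert_of_mem hj))

theorem qPoch (hx : Specializes φ x c) (hy : Specializes φ y d) (k : ℕ) :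
    Specializes φ (qPoch x y k) (QDouble.qPoch c d k) :=
  prod fun i _ => one.sub (hx.mul (hy.pow i))

theorem qInt (hx : Specializes φ x c) (k : ℕ) :
    Specializes φ (qInt x k) (QDouble.qInt c k) :=
  sum fun i _ => hx.pow i

theorem lamDen (hx : Specializes φ x c) (hy : Specializes φ y d) (hc : c ≠ 0) (k : ℕ) :
    Specializes φ (lamDen x y k) (QDouble.lamDen c d k) :=
  (((hy.pow 2).qPoch (hy.pow 2) k).pow 2).mul
    ((((hy.pow 2).div hx hc).qPoch (hy.pow 2) k).mul ((hx.mul (hy.pow 2)).qPoch (hy.pow 2) k))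

theorem lamNum (hx : Specializes φ x c) (hy : Specializes φ y d) (hc : c ≠ 0) (k : ℕ) :
    Specializes φ (lamNum x y k) (QDouble.lamNum c d k) :=
  ((hy.qPoch (hy.pow 2) k).pow 2).mul
    (((hx.mul hy).qPoch (hy.pow 2) k).mul ((hy.div hx hc).qPoch (hy.pow 2) k))

theorem lam (hx : Specializes φ x c) (hy : Specializes φ y d) (hc : c ≠ 0) {k : ℕ}
    (hk : QDouble.lamDen c d k ≠ 0) : Specializes φ (lam x y k) (QDouble.lam c d k) :=
  (hy.qInt _).mul ((lamNum hx hy hc k).div (lamDen hx hy hc k) hk)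

theorem lamTail (hx : Specializes φ x c) (hy : Specializes φ y d) (hc : c ≠ 0) {M r : ℕ}
    (hk : QDouble.lamDen c d (M + 1 + r) ≠ 0) :
    Specializes φ (lamTail x y M r) (QDouble.lamTail c d M r) :=
  (hy.qInt _).mul (((((hy.qPoch (hy.pow 2) M).mul ((hy.pow _).qPoch (hy.pow 2) r)).pow 2).mul
    (((hx.mul hy).qPoch (hy.pow 2) _).mul ((hy.div hx hc).qPoch (hy.pow 2) _))).div
      (lamDen hx hy hc _) hk)

end Specializes

theorem exists_residueField {P : PolyAQ} (hP : Prime P) :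
    ∃ (κ : Type) (_ : Field κ) (φ : PolyAQ →+* κ), ∀ N, φ N = 0 ↔ P ∣ N := by
  have : (Ideal.span {P}).IsPrime := (Ideal.span_singleton_prime hP.ne_zero).2 hP
  refine ⟨(Ideal.span {P}).ResidueField, inferInstance, algebraMap PolyAQ _, fun N => ?_⟩
  rw [Ideal.algebraMap_residueField_eq_zero, Ideal.mem_span_singleton]

/-- Reduced fractions exist because ℤ[a, q] is a UFD. In this form congruences modulo coprime
factors can be multiplied together. -/
theorem ratModEq_iff_dvd_num {P : PolyAQ} {A B : RatAQ} :
    RatModEq P A B ↔ P ∣ IsFractionRing.num PolyAQ (A - B) := by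
  have hred := IsFractionRing.num_den_reduced PolyAQ (A - B)
  have hx := IsFractionRing.mk'_num_den' PolyAQ (A - B)
  have hd : (IsFractionRing.den PolyAQ (A - B) : PolyAQ) ≠ 0 := nonZeroDivisors.coe_ne_zero _
  constructor
  · rintro ⟨N, D, hD, hrel, h⟩
    rw [← hx, div_eq_div_iff (by simp) (by simpa using hD), ← map_mul, ← map_mul,
      (FaithfulSMul.algebraMap_injective PolyAQ RatAQ).eq_iff] at h
    exact hrel.symm.dvd_of_dvd_mul_right ⟨N * IsFractionRing.den PolyAQ (A - B), by rw [h]; ring⟩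
  · rintro ⟨N, hN⟩
    exact ⟨N, _, hd, (hred.symm.of_dvd_right ⟨N, hN⟩), by rw [← hN, hx]⟩

/-- Vanishing of z in the residue field supplies one more factor P beyond the explicit P^e. -/
theorem ratModEq_of_specializes {P : PolyAQ} (hP : Prime P) {φ : PolyAQ →+* κ}
    (hφ : ∀ N, φ N = 0 ↔ P ∣ N) {A B z : RatAQ} (e : ℕ)
    (h : A - B = algebraMap PolyAQ RatAQ P ^ e * z) (hz : Specializes φ z 0) :
    RatModEq (P ^ (e + 1)) A B := by
  obtain ⟨N, D, h0, rfl, h2⟩ := hz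
  obtain ⟨N', rfl⟩ := (hφ N).1 ((div_eq_zero_iff.1 h2.symm).resolve_right h0)
  refine ⟨N', D, fun h => h0 (by rw [h, map_zero]), ?_, ?_⟩
  · exact (((hP.irreducible.isRelPrime_iff_not_dvd).2 fun h => h0 ((hφ D).2 h)).pow_left).symm
  · rw [h]
    simp only [map_mul, map_pow]
    ring

end specialization

end QDouble
namespace QDouble

/-! ### The prime factors of the modulus and their residue fields -/

open Polynomial

theorem prime_of_prime_swap {P : PolyAQ} (h : Prime (Bivariate.swap P)) : Prime P :=
  (MulEquiv.prime_iff (Bivariate.swap (R := ℤ)).toMulEquiv).1 h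

/-- With the variables swapped it is linear in a with coprime coefficients, hence irreducible, hence
prime in a UFD. -/
theorem prime_one_sub (n : ℕ) : Prime (1 - polyA * polyQ ^ n) := by
  refine prime_of_prime_swap (Irreducible.prime ?_)
  have h : Bivariate.swap (1 - polyA * polyQ ^ n) = C (-X ^ n) * X + C (1 : ℤ[X]) := by
    rw [map_sub, map_mul, map_pow, map_one, polyA, polyQ, Bivariate.swap_X, Bivariate.swap_Y]
    simp only [map_neg, map_pow, map_one]
    ring
  have h0 : (-X ^ n : ℤ[X]) ≠ 0 := by simp
  rw [h]
  refine irreducible_of_degree_eq_one_of_isRelPrime_coeff (degree_linear h0) ?_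
  simp only [coeff_add, coeff_C_mul, coeff_X_zero, mul_zero, coeff_C_zero, zero_add]
  exact isRelPrime_one_left

theorem prime_sub (n : ℕ) : Prime (polyA - polyQ ^ n) := by
  refine prime_of_prime_swap ?_
  have h : Bivariate.swap (polyA - polyQ ^ n) = X - C (X ^ n : ℤ[X]) := by
    rw [map_sub, map_pow, polyA, polyQ, Bivariate.swap_X, Bivariate.swap_Y, map_pow]
  rw [h]
  exact prime_X_sub_C _

theorem prime_cyclotomic {d : ℕ} (hd : 0 < d) : Prime (cyclotomic d ℤ[X]) := by
  refine prime_of_prime_swap ?_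
  have h : Bivariate.swap (cyclotomic d ℤ[X]) = C (cyclotomic d ℤ) := by
    rw [← map_cyclotomic_int d ℤ[X], ← Bivariate.swap_map_C (cyclotomic d ℤ)]
    congr 2
  rw [h, prime_C_iff]
  exact (cyclotomic.irreducible hd).prime

variable {κ : Type*} [Field κ] {φ : PolyAQ →+* κ}

/-- Putting q = 2 leaves P of degree 1 in a, so P cannot divide a polynomial in q alone whose value
at 2 is nonzero, such as q or q^(i+1) - 1. -/
theorem residue_of_natDegree {P : PolyAQ} (hφ : ∀ N, φ N = 0 ↔ P ∣ N)
    (hP : (P.eval 2).natDegree = 1) : φ polyQ ≠ 0 ∧ ∀ i, φ polyQ ^ (i + 1) ≠ 1 := by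
  have key : ∀ f : PolyAQ, ∀ c : ℤ, c ≠ 0 → f.eval 2 = C c → φ f ≠ 0 := by
    intro f c hc hf h
    obtain ⟨g, rfl⟩ := (hφ f).1 h
    have h1 : P.eval 2 ∣ C c := ⟨g.eval 2, by rw [← hf, eval_mul]⟩
    have h2 := natDegree_le_of_dvd h1 (C_ne_zero.2 hc)
    rw [hP, natDegree_C] at h2
    omega
  refine ⟨key polyQ 2 (by norm_num) (by simp [polyQ]), fun i h => ?_⟩
  refine key (polyQ ^ (i + 1) - 1) (2 ^ (i + 1) - 1) ?_ (by simp [polyQ]) (by simp [h])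
  have : (2 : ℤ) ^ i ≥ 1 := one_le_pow₀ (by norm_num)
  rw [pow_succ]
  omega

theorem residue_one_sub {n : ℕ} (hφ : ∀ N, φ N = 0 ↔ 1 - polyA * polyQ ^ n ∣ N) :
    φ polyQ ≠ 0 ∧ ∀ i, φ polyQ ^ (i + 1) ≠ 1 := by
  refine residue_of_natDegree hφ ?_
  have h : eval 2 (1 - polyA * polyQ ^ n) = C (-2 ^ n : ℤ) * X + C 1 := by
    simp only [polyA, polyQ, eval_sub, eval_one, eval_mul, eval_C, eval_pow, eval_X, map_neg,
      map_pow, map_one, map_ofNat]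
    ring
  rw [h]
  exact natDegree_linear (by simp)

theorem residue_sub {n : ℕ} (hφ : ∀ N, φ N = 0 ↔ polyA - polyQ ^ n ∣ N) :
    φ polyQ ≠ 0 ∧ ∀ i, φ polyQ ^ (i + 1) ≠ 1 := by
  refine residue_of_natDegree hφ ?_
  have h : eval 2 (polyA - polyQ ^ n) = X - C (2 ^ n : ℤ) := by
    simp [polyA, polyQ]
  rw [h]
  exact natDegree_X_sub_C _

section cyclotomic

variable {d : ℕ}

/-- Putting a = t reduces non-vanishing in the residue field to divisibility by Φ_d in ℤ[q]. -/
theorem cyclotomic_dvd_map (hφ : ∀ N, φ N = 0 ↔ cyclotomic d ℤ[X] ∣ N)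
    {N : PolyAQ} (h : φ N = 0) (t : ℤ) :
    cyclotomic d ℤ ∣ N.map (evalRingHom t) := by
  have := map_dvd (mapRingHom (evalRingHom t)) ((hφ N).1 h)
  rwa [coe_mapRingHom, map_cyclotomic] at this

theorem residue_polyA_ne_zero (hd : 0 < d) (hφ : ∀ N, φ N = 0 ↔ cyclotomic d ℤ[X] ∣ N) :
     φ polyA ≠ 0 := fun h => by
  have := cyclotomic_dvd_map hφ h 1
  simp only [polyA, map_C, coe_evalRingHom, eval_X, map_one] at this
  exact (cyclotomic.irreducible hd).not_isUnit (isUnit_of_dvd_one this)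

theorem residue_polyA_mul_ne_one (hd : 0 < d) (hφ : ∀ N, φ N = 0 ↔ cyclotomic d ℤ[X] ∣ N)
    (i : ℕ) : φ polyA * φ polyQ ^ i ≠ 1 := fun h => by
  have := cyclotomic_dvd_map hφ (N := 1 - polyA * polyQ ^ i) (by simp [h]) 0
  simp only [polyA, polyQ, Polynomial.map_sub, Polynomial.map_mul, Polynomial.map_one, map_C,
    coe_evalRingHom, eval_X, map_zero, zero_mul, sub_zero] at this
  exact (cyclotomic.irreducible hd).not_isUnit (isUnit_of_dvd_one this)

theorem residue_charZero (hd : 0 < d) (hφ : ∀ N, φ N = 0 ↔ cyclotomic d ℤ[X] ∣ N) :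
     CharZero κ := charZero_of_inj_zero fun m hm => by
  by_contra h0
  have := cyclotomic_dvd_map hφ (N := (m : PolyAQ)) (by simp [hm]) 0
  rw [Polynomial.map_natCast] at this
  have := natDegree_le_of_dvd this (by exact_mod_cast h0)
  rw [natDegree_cyclotomic, natDegree_natCast] at this
  exact absurd (Nat.totient_pos.2 hd) (by omega)

theorem residue_isPrimitiveRoot (hd : 0 < d) (hφ : ∀ N, φ N = 0 ↔ cyclotomic d ℤ[X] ∣ N) :
     IsPrimitiveRoot (φ polyQ) d := by
  have := residue_charZero hd hφ
  have : NeZero (d : κ) := ⟨Nat.cast_ne_zero.2 hd.ne'⟩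
  rw [← isRoot_cyclotomic_iff, IsRoot.def]
  have h : φ (cyclotomic d ℤ[X]) = 0 := (hφ _).2 dvd_rfl
  have h2 : cyclotomic d ℤ[X] = eval₂ (Int.castRingHom PolyAQ) polyQ (cyclotomic d ℤ) := by
    rw [← map_cyclotomic_int d ℤ[X], polyQ, map, 
      Subsingleton.elim (C.comp (Int.castRingHom ℤ[X]))]
  rw [h2, hom_eval₂, Subsingleton.elim (φ.comp _) (Int.castRingHom κ),
    ← eval_map, map_cyclotomic_int] at h
  exact h

end cyclotomic

end QDouble
namespace QDouble

/-! ### The double sum, and the case a = q^(±n) -/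

section doubleSum

theorem doubleSum_eq {F : Type*} [Field F] (a q : F) (N : ℕ) :
    doubleSum a q N = ∑ i ∈ Finset.range (N + 1), lam a q i *
      ∑ j ∈ Finset.range (N + 1 - i), lam a q j := by
  rw [doubleSum, Finset.sum_filter, Finset.sum_product]
  refine Finset.sum_congr rfl fun i hi => ?_
  rw [← Finset.sum_filter, Finset.mul_sum]
  refine Finset.sum_congr ?_ fun _ _ => rfl
  ext j
  simp only [Finset.mem_filter, Finset.mem_range]
  omega

/-- Two indices above M would sum to more than 2M. So the pairs are the full square on 0..M and,
twice by symmetry, those with one index above M. -/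
theorem sum_triangle_eq {R : Type*} [CommRing R] (f : ℕ → R) (M : ℕ) :
    ∑ i ∈ Finset.range (2 * M + 1), f i * ∑ j ∈ Finset.range (2 * M + 1 - i), f j =
      (∑ i ∈ Finset.range (M + 1), f i) ^ 2 +
        2 * ∑ r ∈ Finset.range M, f (M + 1 + r) * ∑ i ∈ Finset.range (M - r), f i := by
  have h1 : ∀ i ∈ Finset.range (M + 1), f i * ∑ j ∈ Finset.range (2 * M + 1 - i), f j =
      f i * ∑ j ∈ Finset.range (M + 1), f j +
        ∑ r ∈ Finset.range (M - i), f i * f (M + 1 + r) := fun i hi => by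
    have := Finset.mem_range.1 hi
    rw [show 2 * M + 1 - i = M + 1 + (M - i) by omega, Finset.sum_range_add, mul_add,
      Finset.mul_sum (s := Finset.range (M - i))]
  have h2 : ∑ i ∈ Finset.range (M + 1), ∑ r ∈ Finset.range (M - i), f i * f (M + 1 + r) =
      ∑ r ∈ Finset.range M, f (M + 1 + r) * ∑ i ∈ Finset.range (M - r), f i := by
    simp only [Finset.mul_sum]
    rw [Finset.sum_comm' (t' := Finset.range M) (s' := fun r => Finset.range (M - r))]
    · exact Finset.sum_congr rfl fun _ _ => Finset.sum_congr rfl fun _ _ => mul_comm _ _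
    · intro i r
      simp only [Finset.mem_range]
      omega
  have h3 : ∀ r ∈ Finset.range M,
      f (M + 1 + r) * ∑ j ∈ Finset.range (2 * M + 1 - (M + 1 + r)), f j =
        f (M + 1 + r) * ∑ i ∈ Finset.range (M - r), f i := fun r _ => by
    rw [show 2 * M + 1 - (M + 1 + r) = M - r by omega]
  have h4 : Finset.range (2 * M + 1) = Finset.range (M + 1 + M) := by congr 1; omega
  rw [h4, Finset.sum_range_add, Finset.sum_congr rfl h1, Finset.sum_add_distrib, h2,
    Finset.sum_congr rfl h3, ← Finset.sum_mul]
  ring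

/-- The right-hand side of the congruence, for `n = 2 M + 1`. -/
def closedForm {F : Type*} [Field F] (a q : F) (M : ℕ) : F :=
  qInt q (2 * M + 1) ^ 2 * ((q ^ (2 * M))⁻¹ *
    (1 + (1 - a * q ^ (2 * M + 1)) * (a - q ^ (2 * M + 1)) / (1 - a) ^ 2 *
      (1 - qPoch (q ^ 2) (q ^ 2) M ^ 4 /
        (qPoch (a * q ^ 2) (q ^ 2) M * qPoch (q ^ 2 / a) (q ^ 2) M) ^ 2)))

theorem lamDen_inv {F : Type*} [Field F] (a q : F) (k : ℕ) : lamDen a⁻¹ q k = lamDen a q k := by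
  rw [lamDen, lamDen, div_inv_eq_mul, inv_mul_eq_div, mul_comm _ a,
    mul_comm (qPoch (a * q ^ 2) _ k)]

variable {κ : Type*} [Field κ] {φ : PolyAQ →+* κ}

namespace Specializes

theorem ratA : Specializes φ ratA (φ polyA) := algebraMap polyA

theorem ratQ : Specializes φ ratQ (φ polyQ) := algebraMap polyQ

/-- The factor of `closedForm` other than the square of a `q`-integer. -/
theorem closedForm_factor (a0 : φ polyA ≠ 0) (q0 : φ polyQ ≠ 0) (a1 : 1 - φ polyA ≠ 0) {M : ℕ}
    (h1 : QDouble.qPoch (φ polyQ ^ 2 / φ polyA) (φ polyQ ^ 2) M ≠ 0)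
    (h2 : QDouble.qPoch (φ polyA * φ polyQ ^ 2) (φ polyQ ^ 2) M ≠ 0) :
    Specializes φ ((QDouble.ratQ ^ (2 * M))⁻¹ *
      (1 + (1 - QDouble.ratA * QDouble.ratQ ^ (2 * M + 1)) *
        (QDouble.ratA - QDouble.ratQ ^ (2 * M + 1)) / (1 - QDouble.ratA) ^ 2 *
      (1 - QDouble.qPoch (QDouble.ratQ ^ 2) (QDouble.ratQ ^ 2) M ^ 4 /
        (QDouble.qPoch (QDouble.ratA * QDouble.ratQ ^ 2) (QDouble.ratQ ^ 2) M *
          QDouble.qPoch (QDouble.ratQ ^ 2 / QDouble.ratA) (QDouble.ratQ ^ 2) M) ^ 2)))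
      ((φ polyQ ^ (2 * M))⁻¹ *
      (1 + (1 - φ polyA * φ polyQ ^ (2 * M + 1)) *
        (φ polyA - φ polyQ ^ (2 * M + 1)) / (1 - φ polyA) ^ 2 *
      (1 - QDouble.qPoch (φ polyQ ^ 2) (φ polyQ ^ 2) M ^ 4 /
        (QDouble.qPoch (φ polyA * φ polyQ ^ 2) (φ polyQ ^ 2) M *
          QDouble.qPoch (φ polyQ ^ 2 / φ polyA) (φ polyQ ^ 2) M) ^ 2))) := by
  have q2 := (ratQ (φ := φ)).pow 2
  refine ((ratQ.pow _).inv (pow_ne_zero _ q0)).mul (one.add (Specializes.mul (Specializes.div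
    ((one.sub (ratA.mul (ratQ.pow _))).mul (ratA.sub (ratQ.pow _))) ((one.sub ratA).pow 2)
    (pow_ne_zero _ a1)) (one.sub (Specializes.div ((q2.qPoch q2 M).pow 4)
    ((((ratA.mul q2).qPoch q2 M).mul ((q2.div ratA a0).qPoch q2 M)).pow 2)
    (pow_ne_zero _ (mul_ne_zero h2 h1))))))

theorem closedForm (a0 : φ polyA ≠ 0) (q0 : φ polyQ ≠ 0) (a1 : 1 - φ polyA ≠ 0) {M : ℕ}
    (hD : QDouble.lamDen (φ polyA) (φ polyQ) M ≠ 0) :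
    Specializes φ (closedForm QDouble.ratA QDouble.ratQ M)
      (QDouble.closedForm (φ polyA) (φ polyQ) M) :=
  by
  obtain ⟨-, h⟩ := mul_ne_zero_iff.1 hD
  obtain ⟨h1, h2⟩ := mul_ne_zero_iff.1 h
  exact ((ratQ.qInt _).pow 2).mul (closedForm_factor a0 q0 a1 h1 h2)

end Specializes

theorem doubleSum_eq_sq {F : Type*} [Field F] {a q : F} {M : ℕ}
    (h : ∀ k, M < k → lam a q k = 0) :
    doubleSum a q (2 * M) = (∑ k ∈ Finset.range (M + 1), lam a q k) ^ 2 := by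
  rw [doubleSum_eq, sum_triangle_eq, Finset.sum_eq_zero (s := Finset.range M), mul_zero, add_zero]
  intro r _
  rw [h _ (by omega), zero_mul]

theorem pow_injective_of_ne_one {F : Type*} [Field F] {q : F} (hq : ∀ i, q ^ (i + 1) ≠ 1)
    (q0 : q ≠ 0) {i j : ℕ} (h : q ^ i = q ^ j) : i = j := by
  wlog hij : i ≤ j generalizing i j
  · exact (this h.symm (by omega)).symm
  obtain ⟨k, rfl⟩ := Nat.exists_eq_add_of_le hij
  cases k with
  | zero => rfl
  | succ k =>
    rw [pow_add] at h
    exact absurd (mul_left_cancel₀ (pow_ne_zero i q0) (h.symm.trans (mul_one _).symm)) (hq k)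

theorem lamDen_pow_ne_zero {F : Type*} [Field F] {q : F} (hq : ∀ i, q ^ (i + 1) ≠ 1)
    (q0 : q ≠ 0) (M k : ℕ) : lamDen (q ^ (2 * M + 1)) q k ≠ 0 := by
  refine mul_ne_zero (pow_ne_zero _ ?_) (mul_ne_zero ?_ ?_) <;>
    refine qPoch_ne_zero_iff.2 fun i _ => sub_ne_zero.2 fun h => ?_
  · exact hq (2 * i + 1) (by rw [h]; ring)
  · rw [div_mul_eq_mul_div, eq_comm, div_eq_one_iff_eq (pow_ne_zero _ q0), ← pow_mul,
      ← pow_add] at h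
    have := pow_injective_of_ne_one hq q0 h
    omega
  · exact hq (2 * M + 2 * i + 2) (by rw [h]; ring)

theorem doubleSum_sub_closedForm_eq_zero {F : Type*} [Field F] {q : F}
    (hq : ∀ i, q ^ (i + 1) ≠ 1) (q0 : q ≠ 0) (M : ℕ) {a : F}
    (ha : a = q ^ (2 * M + 1) ∨ a = (q ^ (2 * M + 1))⁻¹) :
    doubleSum a q (2 * M) - closedForm a q M = 0 := by
  have hlam : ∀ k, lam a q k = lam (q ^ (2 * M + 1)) q k := fun k => by
    rcases ha with rfl | rfl
    · rfl
    · rw [lam_inv]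
  have hz : ∀ k, M < k → lam a q k = 0 := fun k hk => by
    rw [hlam, lam_eq, lamNum, qPoch_eq_zero (x := q / q ^ (2 * M + 1)) hk]
    · simp
    · rw [div_mul_eq_mul_div, div_eq_one_iff_eq (pow_ne_zero _ q0)]
      ring
  have hprod : (1 - a * q ^ (2 * M + 1)) * (a - q ^ (2 * M + 1)) = 0 := by
    rcases ha with rfl | rfl
    · rw [sub_self, mul_zero]
    · rw [inv_mul_cancel₀ (pow_ne_zero _ q0), sub_self, zero_mul]
  have hs := sum_lam_pow M hq q0
  rw [doubleSum_eq_sq hz, Finset.sum_congr rfl fun k _ => hlam k, closedForm, hprod, ← hs]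
  have := pow_ne_zero M q0
  field_simp
  ring

theorem specializes_doubleSum_sub_closedForm {M : ℕ} (q0 : φ polyQ ≠ 0)
    (hq : ∀ i, φ polyQ ^ (i + 1) ≠ 1)
    (ha : φ polyA = φ polyQ ^ (2 * M + 1) ∨ φ polyA = (φ polyQ ^ (2 * M + 1))⁻¹) :
    Specializes φ (doubleSum ratA ratQ (2 * M) - closedForm ratA ratQ M) 0 := by
  have hD : ∀ k, lamDen (φ polyA) (φ polyQ) k ≠ 0 := fun k => by
    rcases ha with h | h
    · rw [h]
      exact lamDen_pow_ne_zero hq q0 M k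
    · rw [h, lamDen_inv]
      exact lamDen_pow_ne_zero hq q0 M k
  have a0 : φ polyA ≠ 0 := by
    rcases ha with h | h <;> rw [h]
    · exact pow_ne_zero _ q0
    · exact inv_ne_zero (pow_ne_zero _ q0)
  have a1 : 1 - φ polyA ≠ 0 := sub_ne_zero.2 fun h1 => by
    rcases ha with h | h
    · exact hq (2 * M) (by rw [← h, ← h1])
    · exact hq (2 * M) (by rw [← inv_inv (_ ^ _), ← h, ← h1, inv_one])
  rw [← doubleSum_sub_closedForm_eq_zero hq q0 M ha]
  refine Specializes.sub ?_ (Specializes.closedForm a0 q0 a1 (hD M))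
  exact Specializes.sum fun p _ =>
    (Specializes.ratA.lam .ratQ a0 (hD _)).mul (Specializes.ratA.lam .ratQ a0 (hD _))

theorem ratQ_pow_ne_one (i : ℕ) : ratQ ^ (i + 1) ≠ 1 := by
  rw [ratQ, ← map_pow, ← map_one (algebraMap PolyAQ RatAQ),
    (FaithfulSMul.algebraMap_injective PolyAQ RatAQ).ne_iff]
  intro h
  have := congrArg Polynomial.natDegree h
  rw [polyQ, Polynomial.natDegree_X_pow, Polynomial.natDegree_one] at this
  omega

theorem ratQ_ne_zero : ratQ ≠ 0 := by
  rw [ratQ, Ne, FaithfulSMul.algebraMap_eq_zero_iff]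
  exact Polynomial.X_ne_zero

theorem ratA_ne_zero : ratA ≠ 0 := by
  rw [ratA, Ne, FaithfulSMul.algebraMap_eq_zero_iff, polyA, Polynomial.C_eq_zero]
  exact Polynomial.X_ne_zero

end doubleSum

/-! ### Modulo Φ_d for d dividing n, d ≠ 1 -/

section properDivisor

variable {κ : Type*} [Field κ] {φ : PolyAQ →+* κ}

theorem lamNum_div_lamDen_add {F : Type*} [Field F] (a q : F) (x k : ℕ) :
    lamNum a q (x + k) / lamDen a q (x + k) = lamNum a q x / lamDen a q x *
      ((qPoch (q ^ (2 * x + 1)) (q ^ 2) k / qPoch (q ^ (2 * x + 2)) (q ^ 2) k) ^ 2 *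
        ((qPoch (a * q ^ (2 * x + 1)) (q ^ 2) k * qPoch (q ^ (2 * x + 1) / a) (q ^ 2) k) /
          (qPoch (q ^ (2 * x + 2) / a) (q ^ 2) k * qPoch (a * q ^ (2 * x + 2)) (q ^ 2) k))) := by
  rw [div_pow, div_mul_div_comm, div_mul_div_comm]
  unfold lamNum lamDen
  rw [qPoch_add q, qPoch_add (a * q), qPoch_add (q / a), qPoch_add (q ^ 2),
    qPoch_add (q ^ 2 / a), qPoch_add (a * q ^ 2),
    show q * (q ^ 2) ^ x = q ^ (2 * x + 1) by ring,
    show a * q * (q ^ 2) ^ x = a * q ^ (2 * x + 1) by ring,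
    show q / a * (q ^ 2) ^ x = q ^ (2 * x + 1) / a by ring,
    show q ^ 2 * (q ^ 2) ^ x = q ^ (2 * x + 2) by ring,
    show a * q ^ 2 * (q ^ 2) ^ x = a * q ^ (2 * x + 2) by ring,
    show q ^ 2 / a * (q ^ 2) ^ x = q ^ (2 * x + 2) / a by ring]
  congr 1 <;> ring

/-- In a run of d factors exactly one above and one below vanish at the root of unity. Both contain
1 - q^d; after cancelling it, the denominator keeps [2u+2] in base q^d, which specializes to the
nonzero integer 2u + 2. -/
theorem exists_specializes_qPoch_div_qPoch [CharZero κ] {m : ℕ}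
    (hq : IsPrimitiveRoot (φ polyQ) (2 * m + 1)) (u : ℕ) :
    ∃ c, Specializes φ (qPoch (ratQ ^ (2 * ((2 * m + 1) * u) + 1)) (ratQ ^ 2) (2 * m + 1) /
      qPoch (ratQ ^ (2 * ((2 * m + 1) * u) + 2)) (ratQ ^ 2) (2 * m + 1)) c := by
  set d := 2 * m + 1 with hd
  have e0 : 1 - ratQ ^ d ≠ 0 := sub_ne_zero.2 (ratQ_pow_ne_one _).symm
  have e1 : qPoch (ratQ ^ (2 * (d * u) + 1)) (ratQ ^ 2) d =
      (1 - ratQ ^ d) * (qPoch (ratQ ^ (2 * (d * u) + 1)) (ratQ ^ 2) m *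
        qInt (ratQ ^ d) (2 * u + 1) * qPoch (ratQ ^ (2 * (d * u) + d + 2)) (ratQ ^ 2) m) := by
    have h := one_sub_mul_qInt (ratQ ^ d) (2 * u + 1)
    rw [show (2 * m + 1) = m + (1 + m) by ring] at hd
    conv_lhs => rw [hd, qPoch_add, qPoch_one_add, ← hd]
    rw [← pow_mul] at h
    rw [← pow_mul, ← pow_add, ← pow_add, show 2 * (d * u) + 1 + 2 * m = d * (2 * u + 1) by
      rw [hd]; ring, show d * (2 * u + 1) + 2 = 2 * (d * u) + d + 2 by ring]
    linear_combination (-qPoch (ratQ ^ (2 * (d * u) + 1)) (ratQ ^ 2) m *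
      qPoch (ratQ ^ (2 * (d * u) + d + 2)) (ratQ ^ 2) m) * h
  have e2 : qPoch (ratQ ^ (2 * (d * u) + 2)) (ratQ ^ 2) d =
      (1 - ratQ ^ d) * (qPoch (ratQ ^ (2 * (d * u) + 2)) (ratQ ^ 2) (2 * m) *
        qInt (ratQ ^ d) (2 * u + 2)) := by
    have h := one_sub_mul_qInt (ratQ ^ d) (2 * u + 2)
    conv_lhs => rw [hd, qPoch_succ, ← hd]
    rw [← pow_mul] at h
    rw [← pow_mul, ← pow_add, show 2 * (d * u) + 2 + 2 * (2 * m) = d * (2 * u + 2) by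
      rw [hd]; ring]
    linear_combination (-qPoch (ratQ ^ (2 * (d * u) + 2)) (ratQ ^ 2) (2 * m)) * h
  rw [e1, e2, mul_div_mul_left _ _ e0]
  have hx : ∀ i k, Specializes φ (qPoch (ratQ ^ i) (ratQ ^ 2) k)
    (qPoch (φ polyQ ^ i) (φ polyQ ^ 2) k) := fun i k =>
      (Specializes.ratQ.pow i).qPoch (Specializes.ratQ.pow 2) k
  refine ⟨_, ((hx _ _).mul ((Specializes.ratQ.pow d).qInt _) |>.mul (hx _ _)).div
    ((hx _ _).mul ((Specializes.ratQ.pow d).qInt _)) (mul_ne_zero ?_ ?_)⟩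
  · rw [show 2 * (d * u) + 2 = d * (2 * u) + 2 by ring, pow_add, pow_mul, hq.pow_eq_one, one_pow,
      one_mul]
    exact qPoch_sq_ne_zero hq (by omega)
  · rw [hq.pow_eq_one, qInt]
    simp only [one_pow, Finset.sum_const, Finset.card_range, nsmul_eq_mul, mul_one]
    exact Nat.cast_ne_zero.2 (by omega)

theorem exists_specializes_lamNum_div_lamDen [CharZero κ] {m : ℕ}
    (hq : IsPrimitiveRoot (φ polyQ) (2 * m + 1))
    (ha : ∀ i, φ polyA * φ polyQ ^ i ≠ 1) (a0 : φ polyA ≠ 0) (u : ℕ) :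
    ∃ c, Specializes φ (lamNum ratA ratQ ((2 * m + 1) * u) / lamDen ratA ratQ ((2 * m + 1) * u))
      c := by
  induction u with
  | zero => exact ⟨1, by simpa [lamNum, lamDen, qPoch_zero] using Specializes.one⟩
  | succ u ih =>
    obtain ⟨c, hc⟩ := ih
    obtain ⟨c', hc'⟩ := exists_specializes_qPoch_div_qPoch hq u
    have q2 := (Specializes.ratQ (φ := φ)).pow 2
    rw [mul_add, mul_one, lamNum_div_lamDen_add]
    refine ⟨_, hc.mul ((hc'.pow 2).mul (Specializes.div
      (((Specializes.ratA.mul (Specializes.ratQ.pow _)).qPoch q2 _).mul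
        (((Specializes.ratQ.pow _).div Specializes.ratA a0).qPoch q2 _))
      ((((Specializes.ratQ.pow _).div Specializes.ratA a0).qPoch q2 _).mul
        ((Specializes.ratA.mul (Specializes.ratQ.pow _)).qPoch q2 _)) (mul_ne_zero ?_ ?_)))⟩
    · exact qPoch_div_ne_zero hq.pow_eq_one ha a0 _ _
    · exact qPoch_mul_pow_ne_zero ha _ _

theorem specializes_lam_add {m : ℕ} (hm : m ≠ 0)
    (hq : IsPrimitiveRoot (φ polyQ) (2 * m + 1))
    (ha : ∀ i, φ polyA * φ polyQ ^ i ≠ 1) (a0 : φ polyA ≠ 0) {u r : ℕ} (hr : r < 2 * m + 1) {c : κ}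
    (hc : Specializes φ
      (lamNum ratA ratQ ((2 * m + 1) * u) / lamDen ratA ratQ ((2 * m + 1) * u)) c) :
    Specializes φ (lam ratA ratQ ((2 * m + 1) * u + r)) (c * lam (φ polyA) (φ polyQ) r) := by
  have q2 := (Specializes.ratQ (φ := φ)).pow 2
  have hp : ∀ i, φ polyQ ^ (2 * ((2 * m + 1) * u) + i) = φ polyQ ^ i := fun i => by
    rw [show 2 * ((2 * m + 1) * u) + i = (2 * m + 1) * (2 * u) + i by ring, pow_add, pow_mul,
      hq.pow_eq_one, one_pow, one_mul]
  have hi : qInt (φ polyQ) (4 * ((2 * m + 1) * u + r) + 1) = qInt (φ polyQ) (4 * r + 1) := by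
    rw [show 4 * ((2 * m + 1) * u + r) + 1 = (2 * m + 1) * (4 * u) + (4 * r + 1) by ring,
      qInt_congr hq.pow_eq_one (hq.ne_one (by omega))]
  have hl : c * lam (φ polyA) (φ polyQ) r = qInt (φ polyQ) (4 * ((2 * m + 1) * u + r) + 1) *
      (c * ((qPoch (φ polyQ ^ (2 * ((2 * m + 1) * u) + 1)) (φ polyQ ^ 2) r /
        qPoch (φ polyQ ^ (2 * ((2 * m + 1) * u) + 2)) (φ polyQ ^ 2) r) ^ 2 *
      ((qPoch (φ polyA * φ polyQ ^ (2 * ((2 * m + 1) * u) + 1)) (φ polyQ ^ 2) r *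
        qPoch (φ polyQ ^ (2 * ((2 * m + 1) * u) + 1) / φ polyA) (φ polyQ ^ 2) r) /
      (qPoch (φ polyQ ^ (2 * ((2 * m + 1) * u) + 2) / φ polyA) (φ polyQ ^ 2) r *
        qPoch (φ polyA * φ polyQ ^ (2 * ((2 * m + 1) * u) + 2)) (φ polyQ ^ 2) r)))) := by
    rw [hp, hp, hi, lam, pow_one, div_pow, div_mul_div_comm]
    ring
  rw [hl, lam_eq, lamNum_div_lamDen_add]
  refine (Specializes.ratQ.qInt _).mul (hc.mul (((Specializes.div
    ((Specializes.ratQ.pow _).qPoch q2 _) ((Specializes.ratQ.pow _).qPoch q2 _) ?_).pow 2).mul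
    (Specializes.div
      (((Specializes.ratA.mul (Specializes.ratQ.pow _)).qPoch q2 _).mul
        (((Specializes.ratQ.pow _).div Specializes.ratA a0).qPoch q2 _))
      ((((Specializes.ratQ.pow _).div Specializes.ratA a0).qPoch q2 _).mul
        ((Specializes.ratA.mul (Specializes.ratQ.pow _)).qPoch q2 _)) (mul_ne_zero ?_ ?_))))
  · rw [hp]
    exact qPoch_sq_ne_zero hq hr
  · exact qPoch_div_ne_zero hq.pow_eq_one ha a0 _ _
  · exact qPoch_mul_pow_ne_zero ha _ _

theorem sum_periodic_eq_zero {R : Type*} [CommRing R] {d m : ℕ} (hm : m < d) {c l f : ℕ → R}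
    (hf : ∀ u r, r < d → f (d * u + r) = c u * l r)
    (hl : ∀ s, m < s → s ≤ d → ∑ r ∈ Finset.range s, l r = 0) (v s : ℕ) (hs : m < s) (hsd : s ≤ d) :
    ∑ j ∈ Finset.range (d * v + s), f j = 0 := by
  have key : ∀ v s, m < s → s ≤ d → ∑ r ∈ Finset.range s, f (d * v + r) = 0 := by
    intro v s h1 h2
    rw [Finset.sum_congr rfl fun r hr => hf v r ((Finset.mem_range.1 hr).trans_le h2),
      ← Finset.mul_sum, hl s h1 h2, mul_zero]
  have h0 : ∀ v, ∑ j ∈ Finset.range (d * v), f j = 0 := by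
    intro v
    induction v with
    | zero => simp
    | succ v ih => rw [mul_add, mul_one, Finset.sum_range_add, ih, key v d hm le_rfl, add_zero]
  rw [Finset.sum_range_add, h0, key v s hs hsd, add_zero]

/-- If i mod d > m then f(i) = 0. Otherwise the inner range consists of full blocks and one of
length d - (i mod d) > m, each summing to zero. -/
theorem sum_triangle_periodic_eq_zero {R : Type*} [CommRing R] {d m e : ℕ} (hm : d = 2 * m + 1)
    {c l f : ℕ → R} (hf : ∀ u r, r < d → f (d * u + r) = c u * l r)
    (hl0 : ∀ r, m < r → l r = 0) (hl : ∑ r ∈ Finset.range (m + 1), l r = 0) :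
    ∑ i ∈ Finset.range (d * e), f i * ∑ j ∈ Finset.range (d * e - i), f j = 0 := by
  have hl' : ∀ s, m < s → s ≤ d → ∑ r ∈ Finset.range s, l r = 0 := by
    intro s h1 _
    obtain ⟨k, rfl⟩ := Nat.exists_eq_add_of_le (Nat.succ_le_of_lt h1)
    rw [Finset.sum_range_add, hl, zero_add]
    exact Finset.sum_eq_zero fun r _ => hl0 _ (by omega)
  refine Finset.sum_eq_zero fun i hi => ?_
  have hi := Finset.mem_range.1 hi
  have hd : 0 < d := by omega
  have hmod := Nat.mod_lt i hd
  have hdiv := Nat.div_add_mod i d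
  rcases lt_or_ge m (i % d) with h | h
  · rw [← hdiv, hf _ _ hmod, hl0 _ h, mul_zero, zero_mul]
  · have hlt : i / d < e := Nat.div_lt_of_lt_mul hi
    obtain ⟨k, hk⟩ := Nat.exists_eq_add_of_lt hlt
    have : d * e - i = d * k + (d - i % d) := by
      have : d * e = d * (i / d) + d * k + d := by rw [hk]; ring
      omega
    rw [this, sum_periodic_eq_zero (by omega) hf hl' k _ (by omega) (by omega), mul_zero]

theorem specializes_of_primitiveRoot_of_dvd [CharZero κ] {m M : ℕ} (hm : m ≠ 0)
    (hq : IsPrimitiveRoot (φ polyQ) (2 * m + 1)) (hM : 2 * m + 1 ∣ 2 * M + 1)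
    (ha : ∀ i, φ polyA * φ polyQ ^ i ≠ 1) (a0 : φ polyA ≠ 0) :
    Specializes φ (doubleSum ratA ratQ (2 * M) - closedForm ratA ratQ M) 0 := by
  choose c hc using exists_specializes_lamNum_div_lamDen hq ha a0
  have hn : φ polyQ ^ (2 * M + 1) = 1 := (hq.pow_eq_one_iff_dvd _).2 hM
  have q1 : φ polyQ ≠ 1 := hq.ne_one (by omega)
  have hI : qInt (φ polyQ) (2 * M + 1) = 0 := by
    refine (mul_eq_zero.1 ?_).resolve_left (sub_ne_zero.2 q1.symm)
    rw [one_sub_mul_qInt, hn, sub_self]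
  set f : ℕ → κ := fun j => c (j / (2 * m + 1)) * lam (φ polyA) (φ polyQ) (j % (2 * m + 1)) with hf
  have hlam : ∀ j, Specializes φ (lam ratA ratQ j) (f j) := fun j => by
    have := specializes_lam_add hm hq ha a0 (Nat.mod_lt j (show 2 * m + 1 > 0 by omega))
      (hc (j / (2 * m + 1)))
    rwa [Nat.div_add_mod] at this
  have hsum : Specializes φ (doubleSum ratA ratQ (2 * M)) (∑ i ∈ Finset.range (2 * M + 1),
      f i * ∑ j ∈ Finset.range (2 * M + 1 - i), f j) := by
    rw [doubleSum_eq]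
    exact Specializes.sum fun i _ => (hlam i).mul (Specializes.sum fun j _ => hlam j)
  obtain ⟨e, he⟩ := hM
  rw [he, sum_triangle_periodic_eq_zero (c := c) (l := lam (φ polyA) (φ polyQ)) rfl] at hsum
  · rw [← sub_zero (0 : κ)]
    refine hsum.sub ?_
    have := ((Specializes.ratQ.qInt (2 * M + 1)).pow 2).mul (Specializes.closedForm_factor
      (M := M) a0 (hq.ne_zero (by omega)) (sub_ne_zero.2 fun h => ha 0 (by simp [← h]))
      (qPoch_div_ne_zero hn ha a0 2 M) (qPoch_mul_pow_ne_zero ha 2 M))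
    rw [hI] at this
    simpa [closedForm] using this
  · intro u r hr
    simp only [hf]
    rw [Nat.mul_add_div (by omega), Nat.div_eq_of_lt hr, Nat.mul_add_mod, Nat.mod_eq_of_lt hr,
      add_zero]
  · exact fun r hr => lam_eq_zero hq.pow_eq_one hr
  · exact sum_lam_eq_zero hm hq ha a0

end properDivisor

end QDouble
namespace QDouble

/-! ### Modulo the cube of Φ_n -/

section cubeOfCyclotomic

variable {κ : Type*} [Field κ] {φ : PolyAQ →+* κ} {M : ℕ}

theorem Specializes.ne_zero {x : RatAQ} {c : κ} (hx : Specializes φ x c) (hc : c ≠ 0) : x ≠ 0 := by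
  obtain ⟨N, D, h0, rfl, rfl⟩ := hx
  exact div_ne_zero (algebraMap_ne_zero_of_map (div_ne_zero_iff.1 hc).1)
    (algebraMap_ne_zero_of_map h0)

/-- `(q ^ (1 - n); q²)_k (q²; q²)_k q ^ (n k) / ((q; q²)_k (q ^ (n + 2); q²)_k)`, where
`n = 2 M + 1`. -/
def deformFactor {F : Type*} [Field F] (q : F) (M k : ℕ) : F :=
  ∏ i ∈ Finset.range k, (q ^ (2 * M + 1) - q ^ (2 * i + 1)) * (1 - q ^ (2 * i + 2)) /
    ((1 - q ^ (2 * i + 1)) * (1 - q ^ (2 * M + 1) * q ^ (2 * i + 2)))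

/-- With ε = 1 - q^n, each factor of the product is 1 + εt, so h is the first-order coefficient up
to multiples of ε, and these vanish under `φ`. -/
theorem exists_deformFactor_eq (hq : IsPrimitiveRoot (φ polyQ) (2 * M + 1)) {k : ℕ} (hk : k ≤ M) :
    ∃ h, deformFactor ratQ M k = 1 + (1 - ratQ ^ (2 * M + 1)) * h ∧
      Specializes φ h (logDeriv (φ polyQ) k) := by
  induction k with
  | zero =>
    exact ⟨0, by simp [deformFactor], by simpa [logDeriv] using Specializes.zero⟩
  | succ k ih =>
    obtain ⟨h, h1, h2⟩ := ih (by omega)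
    have hQ := Specializes.ratQ (φ := φ)
    have hn := hq.pow_eq_one
    have n1 := sub_ne_zero.2 (ratQ_pow_ne_one (2 * k)).symm
    have n2 : 1 - ratQ ^ (2 * M + 1) * ratQ ^ (2 * k + 2) ≠ 0 := by
      rw [← pow_add, sub_ne_zero]
      exact (ratQ_pow_ne_one (2 * M + 1 + (2 * k + 1))).symm
    have n3 := sub_ne_zero.2 (hq.pow_ne_one_of_pos_of_lt
      (show 2 * k + 1 ≠ 0 by omega) (by omega)).symm
    have n4 := sub_ne_zero.2 (hq.pow_ne_one_of_pos_of_lt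
      (show 2 * k + 2 ≠ 0 by omega) (by omega)).symm
    set t := -((1 - ratQ ^ (2 * k + 2) * ratQ ^ (2 * k + 1)) /
      ((1 - ratQ ^ (2 * k + 1)) * (1 - ratQ ^ (2 * M + 1) * ratQ ^ (2 * k + 2)))) with ht
    have h3 : Specializes φ t (-(1 / (1 - φ polyQ ^ (2 * k + 1)) +
        φ polyQ ^ (2 * k + 2) / (1 - φ polyQ ^ (2 * k + 2)))) := by
      have : 1 / (1 - φ polyQ ^ (2 * k + 1)) + φ polyQ ^ (2 * k + 2) / (1 - φ polyQ ^ (2 * k + 2)) =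
          (1 - φ polyQ ^ (2 * k + 2) * φ polyQ ^ (2 * k + 1)) / ((1 - φ polyQ ^ (2 * k + 1)) *
            (1 - φ polyQ ^ (2 * M + 1) * φ polyQ ^ (2 * k + 2))) := by
        rw [hn, one_mul, div_add_div _ _ n3 n4]
        congr 1
        ring
      rw [this]
      refine Specializes.neg (Specializes.div
        (Specializes.one.sub ((hQ.pow _).mul (hQ.pow _)))
        ((Specializes.one.sub (hQ.pow _)).mul
          (Specializes.one.sub ((hQ.pow _).mul (hQ.pow _)))) (mul_ne_zero n3 ?_))
      rwa [hn, one_mul]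
    refine ⟨h + t + (1 - ratQ ^ (2 * M + 1)) * (h * t), ?_, ?_⟩
    · rw [deformFactor, Finset.prod_range_succ, ← deformFactor, h1]
      have : (ratQ ^ (2 * M + 1) - ratQ ^ (2 * k + 1)) * (1 - ratQ ^ (2 * k + 2)) /
          ((1 - ratQ ^ (2 * k + 1)) * (1 - ratQ ^ (2 * M + 1) * ratQ ^ (2 * k + 2))) =
          1 + (1 - ratQ ^ (2 * M + 1)) * t := by
        rw [ht, eq_comm, eq_div_iff (mul_ne_zero n1 n2), add_mul, mul_assoc, neg_mul,
          div_mul_cancel₀ _ (mul_ne_zero n1 n2)]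
        ring
      rw [this]
      ring
    · have := (h2.add h3).add ((Specializes.one.sub (hQ.pow (2 * M + 1))).mul (h2.mul h3))
      rw [hn, sub_self, zero_mul, add_zero] at this
      rw [logDeriv, Finset.sum_range_succ, neg_add, ← logDeriv]
      exact this

theorem sum_lam_mul_deformFactor (M : ℕ)
    (hD : qPoch (ratQ ^ 2 / ratA) (ratQ ^ 2) M ≠ 0) (hE : qPoch (ratA * ratQ ^ 2) (ratQ ^ 2) M ≠ 0) :
    ∑ k ∈ Finset.range (M + 1), lam ratA ratQ k * deformFactor ratQ M k =
      qInt ratQ (2 * M + 1) * (qPoch ratQ (ratQ ^ 2) M ^ 2 /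
        (qPoch (ratA * ratQ ^ 2) (ratQ ^ 2) M * qPoch (ratQ ^ 2 / ratA) (ratQ ^ 2) M)) := by
  have a0 := ratA_ne_zero
  have e : ratQ ^ 2 / ratA⁻¹ = ratA * ratQ ^ 2 := by rw [div_inv_eq_mul, mul_comm]
  -- The choice b = a, c = 1/a makes bc = 1 and reproduces the a-dependent factors of λ.
  have h := sum_wellPoised M ratQ_pow_ne_one ratQ_ne_zero a0 (inv_ne_zero a0) hD (by rwa [e])
  rw [e, mul_inv_cancel₀ a0, div_one] at h
  have hp : ∀ N, qPoch ratQ (ratQ ^ 2) N ≠ 0 := fun N => qPoch_ne_zero_iff.2 fun i _ => by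
    rw [sub_ne_zero, ← pow_mul, ← pow_succ']
    exact (ratQ_pow_ne_one _).symm
  have hp2 : ∀ N, qPoch (ratQ ^ 2) (ratQ ^ 2) N ≠ 0 := fun N => qPoch_ne_zero_iff.2 fun i _ => by
    rw [sub_ne_zero, ← pow_mul, ← pow_add, add_comm]
    exact (ratQ_pow_ne_one (2 * i + 1)).symm
  refine Eq.trans (Finset.sum_congr rfl fun k _ => ?_) (h.trans ?_)
  · have hg : deformFactor ratQ M k =
        (∏ i ∈ Finset.range k, (ratQ ^ (2 * M + 1) - ratQ ^ (2 * i + 1))) *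
          qPoch (ratQ ^ 2) (ratQ ^ 2) k /
          (qPoch ratQ (ratQ ^ 2) k * qPoch (ratQ ^ (2 * M + 3)) (ratQ ^ 2) k) := by
      rw [deformFactor, Finset.prod_div_distrib, Finset.prod_mul_distrib, Finset.prod_mul_distrib]
      unfold qPoch
      congr 2
      · exact Finset.prod_congr rfl fun i _ => by ring
      · exact Finset.prod_congr rfl fun i _ => by ring
      · exact Finset.prod_congr rfl fun i _ => by ring
    have := hp k
    have := hp2 k
    rw [hg, one_pow, div_one, lam, ← div_eq_mul_inv, mul_comm ratQ ratA]
    field_simp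
  · rw [mul_comm (qPoch (ratA * _) _ _)]
    ring

theorem exists_doubleSum_sub_closedForm_eq [CharZero κ] (hM : M ≠ 0)
    (hq : IsPrimitiveRoot (φ polyQ) (2 * M + 1))
    (ha : ∀ i, φ polyA * φ polyQ ^ i ≠ 1) (a0 : φ polyA ≠ 0) :
    ∃ z, doubleSum ratA ratQ (2 * M) - closedForm ratA ratQ M = (1 - ratQ ^ (2 * M + 1)) ^ 2 * z ∧
      Specializes φ z 0 := by
  have hQ := Specializes.ratQ (φ := φ)
  have hA := Specializes.ratA (φ := φ)
  have hn := hq.pow_eq_one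
  have q1 : 1 - φ polyQ ≠ 0 := sub_ne_zero.2 (hq.ne_one (by omega)).symm
  have q0 : φ polyQ ≠ 0 := hq.ne_zero (by omega)
  have a1 : 1 - φ polyA ≠ 0 := sub_ne_zero.2 fun h => ha 0 (by simp [← h])
  have d1 := qPoch_div_ne_zero hn ha a0 2 M
  have d2 := qPoch_mul_pow_ne_zero ha 2 M
  have hlam : ∀ k < 2 * M + 1,
      Specializes φ (lam ratA ratQ k) (lam (φ polyA) (φ polyQ) k) := fun k hk =>
    hA.lam hQ a0 (lamDen_ne_zero hq ha a0 hk)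
  have e1 : 1 - ratQ ≠ 0 := sub_ne_zero.2 fun h => ratQ_pow_ne_one 0 (by rw [← h, one_pow])
  have r1 : qPoch (ratQ ^ 2 / ratA) (ratQ ^ 2) M ≠ 0 :=
    (((hQ.pow 2).div hA a0).qPoch (hQ.pow 2) M).ne_zero d1
  have r2 : qPoch (ratA * ratQ ^ 2) (ratQ ^ 2) M ≠ 0 :=
    ((hA.mul (hQ.pow 2)).qPoch (hQ.pow 2) M).ne_zero d2
  have hex : ∀ k, ∃ h, k ≤ M → deformFactor ratQ M k = 1 + (1 - ratQ ^ (2 * M + 1)) * h ∧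
      Specializes φ h (logDeriv (φ polyQ) k) := fun k => by
    by_cases hk : k ≤ M
    · obtain ⟨h, hh⟩ := exists_deformFactor_eq hq hk
      exact ⟨h, fun _ => hh⟩
    · exact ⟨0, fun h => absurd h hk⟩
  choose h hh using hex
  have hI : qInt ratQ (2 * M + 1) = (1 - ratQ ^ (2 * M + 1)) * (1 / (1 - ratQ)) := by
    rw [← one_sub_mul_qInt]
    field_simp
  set ε := 1 - ratQ ^ (2 * M + 1) with hε
  set w := qPoch ratQ (ratQ ^ 2) M ^ 2 /
    (qPoch (ratA * ratQ ^ 2) (ratQ ^ 2) M * qPoch (ratQ ^ 2 / ratA) (ratQ ^ 2) M) with hw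
  set C := (ratQ ^ (2 * M))⁻¹ *
    (1 + (1 - ratA * ratQ ^ (2 * M + 1)) * (ratA - ratQ ^ (2 * M + 1)) / (1 - ratA) ^ 2 *
      (1 - qPoch (ratQ ^ 2) (ratQ ^ 2) M ^ 4 /
        (qPoch (ratA * ratQ ^ 2) (ratQ ^ 2) M * qPoch (ratQ ^ 2 / ratA) (ratQ ^ 2) M) ^ 2)) with hC
  -- Subtracting ε ∑ λh from the exact value of ∑ λ(1 + εh) exhibits the factor ε of the single sum.
  have hS : ∑ k ∈ Finset.range (M + 1), lam ratA ratQ k =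
      ε * (1 / (1 - ratQ) * w - ∑ k ∈ Finset.range (M + 1), lam ratA ratQ k * h k) := by
    have hT := sum_lam_mul_deformFactor M r1 r2
    rw [← hw, hI] at hT
    rw [mul_sub, ← mul_assoc, ← hT, Finset.mul_sum, ← Finset.sum_sub_distrib]
    refine Finset.sum_congr rfl fun k hk => ?_
    rw [(hh k (Nat.lt_succ_iff.1 (Finset.mem_range.1 hk))).1]
    ring
  refine ⟨(1 / (1 - ratQ) * w - ∑ k ∈ Finset.range (M + 1), lam ratA ratQ k * h k) ^ 2 +
    2 * ∑ r ∈ Finset.range M, lamTail ratA ratQ M r * ∑ k ∈ Finset.range (M - r), lam ratA ratQ k -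
      (1 / (1 - ratQ)) ^ 2 * C, ?_, ?_⟩
  · rw [doubleSum_eq, sum_triangle_eq, hS, closedForm, ← hC, hI]
    have : ∑ r ∈ Finset.range M, lam ratA ratQ (M + 1 + r) *
        ∑ k ∈ Finset.range (M - r), lam ratA ratQ k = ε ^ 2 * ∑ r ∈ Finset.range M,
          lamTail ratA ratQ M r * ∑ k ∈ Finset.range (M - r), lam ratA ratQ k := by
      rw [Finset.mul_sum]
      exact Finset.sum_congr rfl fun r _ => by rw [lam_eq_lamTail, mul_assoc]
    rw [this]
    ring
  · have s1 : Specializes φ (∑ k ∈ Finset.range (M + 1), lam ratA ratQ k * h k) 0 := by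
      rw [← sum_lam_mul_logDeriv hM hq ha a0]
      refine Specializes.sum fun k hk => ?_
      have hk := Finset.mem_range.1 hk
      exact (hlam k (by omega)).mul (hh k (by omega)).2
    have s2 : Specializes φ (∑ r ∈ Finset.range M, lamTail ratA ratQ M r *
        ∑ k ∈ Finset.range (M - r), lam ratA ratQ k) 0 := by
      rw [← sum_lamTail_mul_sum_lam hM hq ha a0]
      refine Specializes.sum fun r hr => ?_
      have hr := Finset.mem_range.1 hr
      refine (hA.lamTail hQ a0 (lamDen_ne_zero hq ha a0 (by omega))).mul
        (Specializes.sum fun k hk => hlam k ?_)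
      have hk := Finset.mem_range.1 hk
      omega
    have s3 := Specializes.closedForm_factor a0 q0 a1 d1 d2
    have s4 : Specializes φ w _ := ((hQ.qPoch (hQ.pow 2) M).pow 2).div
      (((hA.mul (hQ.pow 2)).qPoch (hQ.pow 2) M).mul (((hQ.pow 2).div hA a0).qPoch (hQ.pow 2) M))
      (mul_ne_zero d2 d1)
    have s5 := Specializes.one.div (Specializes.one.sub hQ) q1
    have := ((((s5.mul s4).sub s1).pow 2).add ((Specializes.one.add .one).mul s2)).sub
      ((s5.pow 2).mul s3)
    rw [one_add_one_eq_two] at this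
    convert this using 1
    -- What remains is w² = C in the residue field: at q^n = 1 the prefactor of the brace is -1,
    -- which cancels the leading 1, and q^(1-n) = q.
    have h4 := qPoch_self_pow_four hn
    have hinv : (φ polyQ ^ (2 * M))⁻¹ = φ polyQ := by
      
      exact inv_eq_of_mul_eq_one_right (by rw [← pow_succ, hn])
    have h5 : (1 - φ polyA) * (φ polyA - 1) / (1 - φ polyA) ^ 2 = -1 := by
      field_simp
      ring
    rw [hn, hinv, mul_one, h5]
    simp only [mul_pow, div_pow, sub_zero]
    rw [← pow_mul, h4]
    ring

end cubeOfCyclotomic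

end QDouble
namespace QDouble

/-! ### Assembling the coprime factors -/

open Polynomial

theorem ratModEq_one_sub (M : ℕ) : RatModEq (1 - polyA * polyQ ^ (2 * M + 1))
    (doubleSum ratA ratQ (2 * M)) (closedForm ratA ratQ M) := by
  have hP := prime_one_sub (2 * M + 1)
  obtain ⟨κ, _, φ, hφ⟩ := exists_residueField hP
  obtain ⟨q0, hq⟩ := residue_one_sub hφ
  have h : φ polyA * φ polyQ ^ (2 * M + 1) = 1 := by
    have := (hφ _).2 dvd_rfl
    rw [map_sub, map_one, map_mul, map_pow] at this
    exact (sub_eq_zero.1 this).symm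
  rw [← pow_one (1 - _)]
  exact ratModEq_of_specializes hP hφ 0 (by rw [pow_zero, one_mul])
    (specializes_doubleSum_sub_closedForm q0 hq (Or.inr (eq_inv_of_mul_eq_one_left h)))

theorem ratModEq_sub (M : ℕ) : RatModEq (polyA - polyQ ^ (2 * M + 1))
    (doubleSum ratA ratQ (2 * M)) (closedForm ratA ratQ M) := by
  have hP := prime_sub (2 * M + 1)
  obtain ⟨κ, _, φ, hφ⟩ := exists_residueField hP
  obtain ⟨q0, hq⟩ := residue_sub hφ
  have h : φ polyA = φ polyQ ^ (2 * M + 1) := by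
    have := (hφ _).2 dvd_rfl
    rw [map_sub, map_pow] at this
    exact sub_eq_zero.1 this
  rw [← pow_one (polyA - _)]
  exact ratModEq_of_specializes hP hφ 0 (by rw [pow_zero, one_mul])
    (specializes_doubleSum_sub_closedForm q0 hq (Or.inl h))

theorem ratModEq_cyclotomic {d M : ℕ} (hd1 : d ≠ 1) (hd : d ∣ 2 * M + 1) :
    RatModEq (cyclotomic d ℤ[X]) (doubleSum ratA ratQ (2 * M)) (closedForm ratA ratQ M) := by
  have hd0 : 0 < d := Nat.pos_of_dvd_of_pos hd (by omega)
  obtain ⟨m, rfl⟩ : Odd d := Odd.of_dvd_nat ⟨M, rfl⟩ hd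
  have hP := prime_cyclotomic hd0
  obtain ⟨κ, _, φ, hφ⟩ := exists_residueField hP
  have := residue_charZero hd0 hφ
  rw [← pow_one (cyclotomic _ _)]
  exact ratModEq_of_specializes hP hφ 0 (by rw [pow_zero, one_mul])
    (specializes_of_primitiveRoot_of_dvd (by omega) (residue_isPrimitiveRoot hd0 hφ) hd
      (residue_polyA_mul_ne_one hd0 hφ) (residue_polyA_ne_zero hd0 hφ))

theorem ratModEq_cyclotomic_pow {M : ℕ} (hM : M ≠ 0) :
    RatModEq (cyclotomic (2 * M + 1) ℤ[X] ^ 3) (doubleSum ratA ratQ (2 * M))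
      (closedForm ratA ratQ M) := by
  have hn : 0 < 2 * M + 1 := by omega
  have hP := prime_cyclotomic hn
  obtain ⟨κ, _, φ, hφ⟩ := exists_residueField hP
  have := residue_charZero hn hφ
  obtain ⟨z, h1, h2⟩ := exists_doubleSum_sub_closedForm_eq hM (residue_isPrimitiveRoot hn hφ)
    (residue_polyA_mul_ne_one hn hφ) (residue_polyA_ne_zero hn hφ)
  obtain ⟨ψ, hψ⟩ : cyclotomic (2 * M + 1) ℤ[X] ∣ 1 - polyQ ^ (2 * M + 1) := by
    rw [← dvd_neg, neg_sub, polyQ]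
    exact cyclotomic.dvd_X_pow_sub_one _ _
  -- Two factors Φ_n come from (1 - q^n)² and the third from the vanishing of z.
  refine ratModEq_of_specializes hP hφ 2 (z := algebraMap PolyAQ RatAQ ψ ^ 2 * z) ?_ ?_
  · have : 1 - ratQ ^ (2 * M + 1) =
        algebraMap PolyAQ RatAQ (cyclotomic (2 * M + 1) ℤ[X]) * algebraMap PolyAQ RatAQ ψ := by
      rw [← map_mul, ← hψ, map_sub, map_one, map_pow, ratQ]
    rw [h1, this]
    ring
  · rw [← mul_zero (φ ψ ^ 2)]
    exact ((Specializes.algebraMap ψ).pow 2).mul h2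

theorem isRelPrime_cyclotomic {d e : ℕ} (hd : 0 < d) (he : 0 < e) (h : d ≠ e) :
    IsRelPrime (cyclotomic d ℤ[X]) (cyclotomic e ℤ[X]) := by
  rw [(prime_cyclotomic hd).irreducible.isRelPrime_iff_not_dvd,
    (prime_cyclotomic hd).dvd_prime_iff_associated (prime_cyclotomic he)]
  exact fun ha => h (cyclotomic_injective
    (eq_of_monic_of_associated (cyclotomic.monic d _) (cyclotomic.monic e _) ha))

theorem isRelPrime_cyclotomic_mul {d n : ℕ} (hd : 0 < d) (hn : d ∣ n) :
    IsRelPrime (cyclotomic d ℤ[X]) ((1 - polyA * polyQ ^ n) * (polyA - polyQ ^ n)) := by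
  have hP := prime_cyclotomic hd
  obtain ⟨κ, _, φ, hφ⟩ := exists_residueField hP
  rw [hP.irreducible.isRelPrime_iff_not_dvd, ← hφ]
  have h1 := (residue_isPrimitiveRoot hd hφ).pow_eq_one_iff_dvd n |>.2 hn
  have h2 := residue_polyA_mul_ne_one hd hφ 0
  rw [pow_zero, mul_one] at h2
  simp only [map_mul, map_sub, map_pow, map_one, h1, mul_one]
  exact mul_ne_zero (sub_ne_zero.2 h2.symm) (sub_ne_zero.2 h2)

theorem isRelPrime_one_sub_sub {n : ℕ} (hn : 0 < n) :
    IsRelPrime (1 - polyA * polyQ ^ n) (polyA - polyQ ^ n) := by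
  have hP := prime_one_sub n
  obtain ⟨κ, _, φ, hφ⟩ := exists_residueField hP
  rw [hP.irreducible.isRelPrime_iff_not_dvd, ← hφ]
  have h := (hφ _).2 dvd_rfl
  obtain ⟨-, hq⟩ := residue_one_sub hφ
  rw [map_sub, map_one, map_mul, map_pow] at h
  rw [map_sub, map_pow, sub_eq_zero]
  intro h2
  rw [h2, ← pow_add, show n + n = 2 * n - 1 + 1 by omega] at h
  exact hq _ (sub_eq_zero.1 h).symm

theorem modulus_eq {n : ℕ} (hn : 1 < n) : modulus n =
    (∏ d ∈ (n.divisors.erase 1).erase n, cyclotomic d ℤ[X]) * cyclotomic n ℤ[X] ^ 3 *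
      ((1 - polyA * polyQ ^ n) * (polyA - polyQ ^ n)) := by
  rw [modulus, qInt, polyQ, ← prod_cyclotomic_eq_geom_sum (by omega),
    ← Finset.prod_erase_mul (n.divisors.erase 1) _
      (Finset.mem_erase.2 ⟨hn.ne', Nat.mem_divisors_self n (by omega)⟩)]
  ring

theorem ratModEq_modulus (M : ℕ) : RatModEq (modulus (2 * M + 1))
    (doubleSum ratA ratQ (2 * M)) (closedForm ratA ratQ M) := by
  by_cases hM : M = 0
  -- For n = 1 both sides equal 1, so the congruence is an equality.
  · subst hM
    refine ⟨0, 1, one_ne_zero, isRelPrime_one_left, ?_⟩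
    simp [doubleSum_eq, lam, closedForm, qPoch_zero, qInt]
  rw [ratModEq_iff_dvd_num, modulus_eq (by omega)]
  have hdiv : ∀ d ∈ ((2 * M + 1).divisors.erase 1).erase (2 * M + 1),
      0 < d ∧ d ≠ 1 ∧ d ≠ 2 * M + 1 ∧ d ∣ 2 * M + 1 := fun d hd => by
    simp only [Finset.mem_erase, Nat.mem_divisors] at hd
    exact ⟨Nat.pos_of_dvd_of_pos hd.2.2.1 (by omega), hd.2.1, hd.1, hd.2.2.1⟩
  refine IsRelPrime.mul_dvd ?_ (IsRelPrime.mul_dvd ?_ ?_ ?_) (IsRelPrime.mul_dvd ?_ ?_ ?_)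
  · refine IsRelPrime.mul_left (IsRelPrime.prod_left fun d hd => ?_) (IsRelPrime.pow_left ?_)
    · exact isRelPrime_cyclotomic_mul (hdiv d hd).1 (hdiv d hd).2.2.2
    · exact isRelPrime_cyclotomic_mul (by omega) dvd_rfl
  · refine IsRelPrime.prod_left fun d hd => IsRelPrime.pow_right ?_
    exact isRelPrime_cyclotomic (hdiv d hd).1 (by omega) (hdiv d hd).2.2.1
  · refine Finset.prod_dvd_of_isRelPrime (fun d hd e he hde => ?_) fun d hd => ?_
    · exact isRelPrime_cyclotomic (hdiv d hd).1 (hdiv e he).1 hde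
    · exact ratModEq_iff_dvd_num.1 (ratModEq_cyclotomic (hdiv d hd).2.1 (hdiv d hd).2.2.2)
  · exact ratModEq_iff_dvd_num.1 (ratModEq_cyclotomic_pow hM)
  · exact isRelPrime_one_sub_sub (by omega)
  · exact ratModEq_iff_dvd_num.1 (ratModEq_one_sub M)
  · exact ratModEq_iff_dvd_num.1 (ratModEq_sub M)

end QDouble

theorem mainTheorem6 (n : ℕ) (hn : Odd n) :
    QDouble.RatModEq (QDouble.modulus n)
      (QDouble.doubleSum QDouble.ratA QDouble.ratQ (n - 1))
      (QDouble.qInt QDouble.ratQ n ^ 2 * QDouble.ratQ ^ (1 - (n : ℤ)) +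
        QDouble.qInt QDouble.ratQ n ^ 2 * QDouble.ratQ ^ (1 - (n : ℤ)) *
          ((1 - QDouble.ratA * QDouble.ratQ ^ n) * (QDouble.ratA - QDouble.ratQ ^ n) /
            (1 - QDouble.ratA) ^ 2) *
          (1 - QDouble.qPoch (QDouble.ratQ ^ 2) (QDouble.ratQ ^ 2) ((n - 1) / 2) ^ 4 /
            (QDouble.qPoch (QDouble.ratA * QDouble.ratQ ^ 2) (QDouble.ratQ ^ 2) ((n - 1) / 2) *
              QDouble.qPoch (QDouble.ratQ ^ 2 / QDouble.ratA) (QDouble.ratQ ^ 2)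
                ((n - 1) / 2)) ^ 2)) := by
  obtain ⟨M, rfl⟩ := hn
  rw [show (2 * M + 1 - 1) / 2 = M by omega, Nat.add_sub_cancel]
  convert QDouble.ratModEq_modulus M using 1
  have h : QDouble.ratQ ^ (1 - ((2 * M + 1 : ℕ) : ℤ)) = (QDouble.ratQ ^ (2 * M))⁻¹ := by
    rw [show 1 - ((2 * M + 1 : ℕ) : ℤ) = -((2 * M : ℕ) : ℤ) by push_cast; ring, zpow_neg,
      zpow_natCast]
  rw [h, QDouble.closedForm]
  ring
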